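/- For a length vector $\lambda\in\mathbb R_+^4$ (all $\lambda_i>0$) put $|\lambda|=\sum_i\lambda_i$ and $I_j=[\sum_{i<j}\lambda_i,\sum_{i\le j}\lambda_i)$. The interval exchange $(\lambda,\pi)$, for a permutation $\pi$ of $\{1,2,3,4\}$, is the map $T$ of $[0,|\lambda|)$ given by $T(x)=x-\sum_{i<j}\lambda_i+\sum_{\pi i<\pi j}\lambda_i$ for $x\in I_j$. It is *minimal* if every forward orbit is dense in $[0,|\lambda|)$, and *uniquely ergodic* if there is exactly one $T$-invariant Borel probability measure on $[0,|\lambda|)$. A marked permutation is a pair $(\nu_0,\nu_1)$ of orderings (bijections from positions to names) of $\{1,2,3,4\}$. The move $a$ replaces $\nu_0$ by the ordering obtained by moving its last name $\nu_0(4)$ to the place just after the name $\nu_1(4)$, and keeps $\nu_1$; its elementary matrix is the identity plus a $1$ in position $(\nu_1(4),\nu_0(4))$. The move $b$ replaces $\nu_1$ by the ordering obtained by moving its last name $\nu_1(4)$ to the place just after the name $\nu_0(4)$, and keeps $\nu_0$; its elementary matrix is the identity plus a $1$ in position $(\nu_0(4),\nu_1(4))$. Let $\pi_0=(\nu_0,\nu_1)$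 with $\nu_0(j)=j$, $\nu_1(j)=5-j$; its permutation $\nu_1^{-1}\circ\nu_0$ is $j\mapsto 5-j$, also denoted $\pi_0=(4321)$. For $n\ge 1$ let $C_n$ be the product, from left to right, of the elementary matrices along the path that starts at $\pi_0$ and follows the word $bab^nab^2\,aba^nba^2$ from left to right, and let $H_n=C_1C_2\cdots C_n$ (with $H_0$ the identity). Let $\Sigma=\{v\in\mathbb R^4: v_i\ge 0,\ \sum_i v_i=1\}$ be the standard simplex and $\Sigma^\circ=\{v\in\Sigma: v_i>0 \text{ for all } i\}$ the open one, on which the matrices act projectively by $v\mapsto Mv/|Mv|$. **Proposition.** There is a vector $\lambda_0$ with all coordinates positive such that the sets $H_n\Sigma$ form a decreasing sequence with $\bigcap_n H_n\Sigma=\{\lambda_0\}$, likewise the sets $H_n\Sigma^\circ$ form a decreasing sequence with $\bigcap_n H_n\Sigma^\circ=\{\lambda_0\}$, and the interval exchange $(\lambda_0,\pi_0)$ is minimal and uniquely ergodic. -/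

import Mathlib

open MeasureTheory

noncomputable section

namespace IntervalExchange

/-! ### Interval exchange maps -/

/-- Left endpoint `∑_{i<j} λ_i` of the `j`-th interval `I_j`. -/
def leftEnd {m : ℕ} (lam : Fin m → ℝ) (j : Fin m) : ℝ := ∑ i with i < j, lam i

/-- Left endpoint `∑_{π i < π j} λ_i` of the image of the `j`-th interval. -/
def imageLeftEnd {m : ℕ} (lam : Fin m → ℝ) (p : Equiv.Perm (Fin m)) (j : Fin m) : ℝ :=
  ∑ i with p i < p j, lam i

/-- The subinterval `I_j = [β_{j-1}, β_j)`. -/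
def subinterval {m : ℕ} (lam : Fin m → ℝ) (j : Fin m) : Set ℝ :=
  Set.Ico (leftEnd lam j) (leftEnd lam j + lam j)

/-- The domain `I = [0, |λ|)`. -/
def domain {m : ℕ} (lam : Fin m → ℝ) : Set ℝ := Set.Ico 0 (∑ i, lam i)

/-- The interval exchange map `T` of `(λ, π)`: for `x ∈ I_j`,
`T x = x - ∑_{i<j} λ_i + ∑_{π i < π j} λ_i`. Outside `I` it is the identity, a harmless
convention: all notions below only look at `T` on `I`. -/
def iet {m : ℕ} (lam : Fin m → ℝ) (p : Equiv.Perm (Fin m)) (x : ℝ) : ℝ :=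
  x + ∑ j, (subinterval lam j).indicator (fun _ => imageLeftEnd lam p j - leftEnd lam j) x

/-- Minimality: every forward orbit of a point of `I` is dense in `I`. -/
def IsMinimal {m : ℕ} (lam : Fin m → ℝ) (p : Equiv.Perm (Fin m)) : Prop :=
  ∀ x ∈ domain lam, domain lam ⊆ closure (Set.range fun n : ℕ => (iet lam p)^[n] x)

/-- Unique ergodicity: exactly one Borel probability measure carried by `I` is `T`-invariant. -/
def IsUniquelyErgodic {m : ℕ} (lam : Fin m → ℝ) (p : Equiv.Perm (Fin m)) : Prop :=
  ∃! μ : Measure ℝ,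
    IsProbabilityMeasure μ ∧ μ (domain lam)ᶜ = 0 ∧ MeasurePreserving (iet lam p) μ μ

/-! ### Marked permutations and Rauzy induction -/

/-- A marked permutation `(ν₀, ν₁)` on the alphabet `Fin (d + 1)`: `top j` and `bot j` are the
names of the `j`-th interval and of the `j`-th image interval, from left to right. -/
structure MarkedPerm (d : ℕ) where
  top : Equiv.Perm (Fin (d + 1))
  bot : Equiv.Perm (Fin (d + 1))

/-- The permutation `π = ν₁⁻¹ ∘ ν₀` of positions. -/
def MarkedPerm.perm {d : ℕ} (x : MarkedPerm d) : Equiv.Perm (Fin (d + 1)) := x.bot⁻¹ * x.top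

/-- The permutation `c_k` of positions: `i ↦ i` for `i ≤ k`, `k + 1 ↦ m`, and
`i ↦ i - 1` for `k + 1 < i ≤ m`, where `m` is the last position. -/
def insertPerm {d : ℕ} (k : Fin (d + 1)) : Equiv.Perm (Fin (d + 1)) where
  toFun i :=
    if i ≤ k then i
    else if i.val = k.val + 1 then Fin.last d
    else ⟨i.val - 1, by omega⟩
  invFun i :=
    if i ≤ k then i
    else if h : i.val = d then ⟨min (k.val + 1) d, by omega⟩
    else ⟨i.val + 1, by omega⟩
  left_inv i := by
    have hi := i.isLt
    have hk := k.isLt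
    by_cases h₁ : i ≤ k
    · simp [h₁]
    · have h₁' : k.val < i.val := by simpa using h₁
      by_cases h₂ : i.val = k.val + 1
      · have h₃ : ¬ Fin.last d ≤ k := by simp only [Fin.le_def, Fin.val_last]; omega
        ext
        simp only [h₁, h₂, h₃, if_false, if_true, Fin.val_last, dif_pos]
        omega
      · have h₃ : ¬ (⟨i.val - 1, by omega⟩ : Fin (d + 1)) ≤ k := by
          simp only [Fin.le_def]; omega
        have h₄ : ¬ i.val - 1 = d := by omega
        ext
        simp only [h₁, h₂, h₃, h₄, if_false, dif_neg, not_false_eq_true]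
        omega
  right_inv i := by
    have hi := i.isLt
    have hk := k.isLt
    by_cases h₁ : i ≤ k
    · simp [h₁]
    · have h₁' : k.val < i.val := by simpa using h₁
      by_cases h₂ : i.val = d
      · have h₃ : ¬ (⟨min (k.val + 1) d, by omega⟩ : Fin (d + 1)) ≤ k := by
          simp only [Fin.le_def]; omega
        have h₄ : min (k.val + 1) d = k.val + 1 := by omega
        ext
        simp only [h₁, h₂, h₃, if_false, dif_pos]
        simp [h₄]
      · have h₃ : ¬ (⟨i.val + 1, by omega⟩ : Fin (d + 1)) ≤ k := by
          simp only [Fin.le_def]; omega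
        have h₄ : ¬ i.val + 1 = k.val + 1 := by omega
        ext
        simp only [h₁, h₂, h₃, h₄, if_false, dif_neg, not_false_eq_true]
        omega

/-- The two types of Rauzy moves. -/
inductive Move where
  | a : Move
  | b : Move

/-- The action of the moves on marked permutations. Move `a` moves the last name of the top row
to the place just after the letter `ν₁(m)` in the top row; move `b` moves the last name of the
bottom row to the place just after the letter `ν₀(m)` in the bottom row. -/
def MarkedPerm.move {d : ℕ} (x : MarkedPerm d) : Move → MarkedPerm d
  | .a => ⟨x.top * insertPerm (x.top⁻¹ (x.bot (Fin.last d))), x.bot⟩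
  | .b => ⟨x.top, x.bot * insertPerm (x.bot⁻¹ (x.top (Fin.last d)))⟩

/-- The elementary matrix `A` of a move, with `λ = A λ'` for the old and new length vectors
(indexed by names): off the diagonal it has a single `1`, at `(ν₁(m), ν₀(m))` for the move `a`
and at `(ν₀(m), ν₁(m))` for the move `b`. -/
def MarkedPerm.moveMatrix {d : ℕ} (x : MarkedPerm d) :
    Move → Matrix (Fin (d + 1)) (Fin (d + 1)) ℝ
  | .a => 1 + Matrix.single (x.bot (Fin.last d)) (x.top (Fin.last d)) 1
  | .b => 1 + Matrix.single (x.top (Fin.last d)) (x.bot (Fin.last d)) 1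

/-- The product `[x; w]` of the elementary matrices along the path that starts at `x` and
follows the letters of `w` from left to right. -/
def MarkedPerm.pathMatrix {d : ℕ} :
    MarkedPerm d → List Move → Matrix (Fin (d + 1)) (Fin (d + 1)) ℝ
  | _, [] => 1
  | x, c :: w => x.moveMatrix c * (x.move c).pathMatrix w

/-! ### The four-interval example -/

/-- `π₀ = (4321)`: `ν₀(j) = j` and `ν₁(j) = 5 - j` for `1 ≤ j ≤ 4`. -/
def pi0 : MarkedPerm 3 := ⟨1, Fin.revPerm⟩

/-- The word `b a bⁿ a b²`. -/
def wordA (n : ℕ) : List Move := [.b, .a] ++ List.replicate n .b ++ [.a, .b, .b]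

/-- The word `a b aⁿ b a²`. -/
def wordB (n : ℕ) : List Move := [.a, .b] ++ List.replicate n .a ++ [.b, .a, .a]

/-- `C_n = [π₀; b a bⁿ a b² a b aⁿ b a²]`. -/
def C (n : ℕ) : Matrix (Fin 4) (Fin 4) ℝ := pi0.pathMatrix (wordA n ++ wordB n)

/-- `H_n = C_1 C_2 ⋯ C_n` (the identity for `n = 0`). -/
def H : ℕ → Matrix (Fin 4) (Fin 4) ℝ
  | 0 => 1
  | n + 1 => H n * C (n + 1)

/-- The projective action of a matrix on vectors, normalised to have coordinate sum `1`. -/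
def projMap {m : ℕ} (M : Matrix (Fin m) (Fin m) ℝ) (v : Fin m → ℝ) : Fin m → ℝ :=
  (∑ i, (M.mulVec v) i)⁻¹ • M.mulVec v

/-- The open standard simplex; the closed one is `stdSimplex ℝ (Fin m)`. -/
def openSimplex (m : ℕ) : Set (Fin m → ℝ) := {v | (∀ i, 0 < v i) ∧ ∑ i, v i = 1}

end IntervalExchange

end

namespace IntervalExchange

open Matrix

/-! ### The matrices `C n` -/

/-! The entries of `C n` grow with `n`, so contraction comes from a Doeblin-type argument rather
than from a recurring positive matrix. (Indices run from 0.) Column `j` of `H (n + 1)` is the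
combination of the columns of `H n` with weights `C (n + 1) i j`. The column sums of `H n` stay
balanced: column 2 is the largest up to a factor 2. In columns 0, 1, 2 of `C (n + 1)` row 2 carries
the dominant weight, so at least a fifth of the mass of each of these columns of `H (n + 1)` comes
from column 2 of `H n`. One more step passes this on to column 3, where a third of the mass comes
from columns 0, 1, 2. Hence every normalised column of `H (n + 2)` contains one and the same vector
with weight 1/15, and the range of each coordinate over the normalised columns shrinks by 14/15
(`RatioBounds.contract`). With compactness, the closed cones meet in one point. Two consecutive
factors have a positive product, so closed and open simplices give interlaced sequences of images
and the same intersection.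

For the dynamics, Rauzy induction turns `lam0 = H n *ᵥ v` into a return system with lengths `v`
(`system_induces_H`). Its intervals have length at most `4⁻ⁿ`, their translates along orbits cover
the whole domain, and positivity of `C (n + 1) * C (n + 2)` makes every orbit visit all of them.
This is minimality (`exists_reach_abs_sub_lt`).

Let `F` be the distribution function of an invariant probability measure. Its increments over the
four intervals form a vector of sum 1 that equals `H n` applied to the nonnegative increments of
level `n`, for every `n`. So this vector lies in every closed cone and equals `lam0`
(`increment_eq_of_inv`). Then `F` fixes the endpoints of the intervals and of their images, hence
the orbit of 0, which is dense; by monotonicity `F` is the identity on `(0, 1)`, and the measure is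
Lebesgue measure. -/

theorem one_add_single_pow {i j : Fin 4} (h : i ≠ j) (n : ℕ) :
    (1 + Matrix.single i j (1 : ℝ)) ^ n = 1 + Matrix.single i j (n : ℝ) := by
  induction n with
  | zero => simp
  | succ n ih =>
    rw [pow_succ, ih, add_mul, mul_add, mul_add, one_mul, one_mul, mul_one,
      Matrix.single_mul_single_of_ne _ _ _ _ h.symm]
    push_cast
    rw [Matrix.single_add]
    abel

theorem MarkedPerm.pathMatrix_replicate_append {d : ℕ} {x : MarkedPerm d} {c : Move}
    (h : x.move c = x) (n : ℕ) (w : List Move) :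
    x.pathMatrix (List.replicate n c ++ w) = x.moveMatrix c ^ n * x.pathMatrix w := by
  induction n with
  | zero => simp
  | succ n ih =>
    rw [List.replicate_succ, List.cons_append, MarkedPerm.pathMatrix, h, ih, pow_succ', mul_assoc]

theorem MarkedPerm.ext_rows {d : ℕ} {x y : MarkedPerm d} (h₁ : x.top = y.top)
    (h₂ : x.bot = y.bot) : x = y := by
  cases x; cases y; simp_all

/-- The block `bⁿ` runs around a loop of length one, so it contributes the `n`-th power of a single
elementary matrix. -/
theorem move_bab : ((pi0.move .b).move .a).move .b = (pi0.move .b).move .a :=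
  MarkedPerm.ext_rows (by decide) (by decide)

theorem move_aba : ((pi0.move .a).move .b).move .a = (pi0.move .a).move .b :=
  MarkedPerm.ext_rows (by decide) (by decide)

/-- This is the word `b a bⁿ a b²` with its loop deleted: the path closes up at `pi0` for every `n`.
-/
theorem move_baabb : ((((pi0.move .b).move .a).move .a).move .b).move .b = pi0 :=
  MarkedPerm.ext_rows (by decide) (by decide)

theorem move_abbaa : ((((pi0.move .a).move .b).move .b).move .a).move .a = pi0 :=
  MarkedPerm.ext_rows (by decide) (by decide)

theorem MarkedPerm.moveMatrix_a {d : ℕ} {x : MarkedPerm d} (i j : Fin (d + 1))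
    (hi : x.bot (Fin.last d) = i) (hj : x.top (Fin.last d) = j) :
    x.moveMatrix .a = 1 + Matrix.single i j 1 := by
  subst hi hj; rfl

theorem MarkedPerm.moveMatrix_b {d : ℕ} {x : MarkedPerm d} (i j : Fin (d + 1))
    (hi : x.top (Fin.last d) = i) (hj : x.bot (Fin.last d) = j) :
    x.moveMatrix .b = 1 + Matrix.single i j 1 := by
  subst hi hj; rfl

theorem one_add_single_eq (i j : Fin 4) (x : ℝ) :
    1 + Matrix.single i j x =
      !![1 + if i = 0 ∧ j = 0 then x else 0, if i = 0 ∧ j = 1 then x else 0,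
          if i = 0 ∧ j = 2 then x else 0, if i = 0 ∧ j = 3 then x else 0;
        if i = 1 ∧ j = 0 then x else 0, 1 + if i = 1 ∧ j = 1 then x else 0,
          if i = 1 ∧ j = 2 then x else 0, if i = 1 ∧ j = 3 then x else 0;
        if i = 2 ∧ j = 0 then x else 0, if i = 2 ∧ j = 1 then x else 0,
          1 + if i = 2 ∧ j = 2 then x else 0, if i = 2 ∧ j = 3 then x else 0;
        if i = 3 ∧ j = 0 then x else 0, if i = 3 ∧ j = 1 then x else 0,
          if i = 3 ∧ j = 2 then x else 0, 1 + if i = 3 ∧ j = 3 then x else 0] := by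
  ext r c
  fin_cases r <;> fin_cases c <;> simp [Matrix.single_apply]

theorem pathMatrix_wordA_append (n : ℕ) (w : List Move) :
    pi0.pathMatrix (wordA n ++ w) =
      !![(1 : ℝ), 0, 0, 0; 0, 2, 2, 1; 0, n, n + 1, 0; 1, 1, 1, 1] * pi0.pathMatrix w := by
  simp only [wordA, List.append_assoc, List.cons_append, List.nil_append, MarkedPerm.pathMatrix]
  rw [MarkedPerm.pathMatrix_replicate_append move_bab]
  simp only [MarkedPerm.pathMatrix]
  rw [move_baabb, MarkedPerm.moveMatrix_b (x := pi0) 3 0 (by decide) (by decide),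
    MarkedPerm.moveMatrix_a (x := pi0.move .b) 1 3 (by decide) (by decide),
    MarkedPerm.moveMatrix_b (x := (pi0.move .b).move .a) 2 1 (by decide) (by decide),
    MarkedPerm.moveMatrix_a (x := (pi0.move .b).move .a) 1 2 (by decide) (by decide),
    MarkedPerm.moveMatrix_b (x := ((pi0.move .b).move .a).move .a) 3 1 (by decide) (by decide),
    MarkedPerm.moveMatrix_b (x := (((pi0.move .b).move .a).move .a).move .b) 3 2
      (by decide) (by decide), one_add_single_pow (by decide)]
  simp only [← mul_assoc]
  congr 1
  simp [one_add_single_eq, one_add_one_eq_two]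

theorem pathMatrix_wordB_append (n : ℕ) (w : List Move) :
    pi0.pathMatrix (wordB n ++ w) =
      !![(1 : ℝ), 1, 1, 1; 0, n + 1, n, 0; 1, 2, 2, 0; 0, 0, 0, 1] * pi0.pathMatrix w := by
  simp only [wordB, List.append_assoc, List.cons_append, List.nil_append, MarkedPerm.pathMatrix]
  rw [MarkedPerm.pathMatrix_replicate_append move_aba]
  simp only [MarkedPerm.pathMatrix]
  rw [move_abbaa, MarkedPerm.moveMatrix_a (x := pi0) 0 3 (by decide) (by decide),
    MarkedPerm.moveMatrix_b (x := pi0.move .a) 2 0 (by decide) (by decide),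
    MarkedPerm.moveMatrix_a (x := (pi0.move .a).move .b) 1 2 (by decide) (by decide),
    MarkedPerm.moveMatrix_b (x := (pi0.move .a).move .b) 2 1 (by decide) (by decide),
    MarkedPerm.moveMatrix_a (x := ((pi0.move .a).move .b).move .b) 0 2 (by decide) (by decide),
    MarkedPerm.moveMatrix_a (x := (((pi0.move .a).move .b).move .b).move .a) 0 1
      (by decide) (by decide), one_add_single_pow (by decide)]
  simp only [← mul_assoc]
  congr 1
  simp [one_add_single_eq, one_add_one_eq_two, add_comm (1 : ℝ) (n : ℝ)]

theorem C_eq (n : ℕ) :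
    C n = !![(1 : ℝ), 1, 1, 1; 2, 2 * n + 6, 2 * n + 4, 1;
      n + 1, (n + 1) * (n + 2), n ^ 2 + 2 * n + 2, 0; 2, n + 4, n + 3, 2] := by
  have h : C n = pi0.pathMatrix (wordA n ++ (wordB n ++ [])) := by simp [C]
  rw [h, pathMatrix_wordA_append, pathMatrix_wordB_append, MarkedPerm.pathMatrix, mul_one]
  ext i j
  fin_cases i <;> fin_cases j <;> simp [Matrix.mul_apply, Fin.sum_univ_four] <;> ring

/-! ### Contraction of the cones `H n` -/

theorem vecMul_C_zero (u : Fin 4 → ℝ) (n : ℕ) :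
    (u ᵥ* C n) 0 = u 0 + 2 * u 1 + (n + 1) * u 2 + 2 * u 3 := by
  simp [C_eq, vecMul, dotProduct, Fin.sum_univ_four]; ring

theorem vecMul_C_one (u : Fin 4 → ℝ) (n : ℕ) :
    (u ᵥ* C n) 1 = u 0 + (2 * n + 6) * u 1 + (n + 1) * (n + 2) * u 2 + (n + 4) * u 3 := by
  simp [C_eq, vecMul, dotProduct, Fin.sum_univ_four]; ring

theorem vecMul_C_two (u : Fin 4 → ℝ) (n : ℕ) :
    (u ᵥ* C n) 2 = u 0 + (2 * n + 4) * u 1 + (n ^ 2 + 2 * n + 2) * u 2 + (n + 3) * u 3 := by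
  simp [C_eq, vecMul, dotProduct, Fin.sum_univ_four]; ring

theorem vecMul_C_three (u : Fin 4 → ℝ) (n : ℕ) :
    (u ᵥ* C n) 3 = u 0 + u 1 + 2 * u 3 := by
  simp [C_eq, vecMul, dotProduct, Fin.sum_univ_four]; ring

theorem C_nonneg (n : ℕ) (i j : Fin 4) : 0 ≤ C n i j := by
  rw [C_eq]
  fin_cases i <;> fin_cases j <;> simp <;> positivity

theorem C_zero_row (n : ℕ) (j : Fin 4) : C n 0 j = 1 := by
  rw [C_eq]
  fin_cases j <;> simp

/-- The only zero of `C n` is the entry (2, 3), so two factors suffice. -/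
theorem C_mul_C_pos (m n : ℕ) (i j : Fin 4) : 0 < (C m * C n) i j := by
  rw [C_eq, C_eq, Matrix.mul_apply, Fin.sum_univ_four]
  fin_cases i <;> fin_cases j <;> simp <;> positivity

/-- Inequalities between the column sums of the matrices `H n`. -/
structure Balanced (a : Fin 4 → ℝ) : Prop where
  pos : ∀ i, 0 < a i
  zero_le_two : a 0 ≤ a 2
  three_le_two : a 3 ≤ a 2
  two_le_one : a 2 ≤ a 1
  one_le_two : a 1 ≤ 2 * a 2

/-- The required inequalities hold entry by entry between the columns of `C n`, and pairing with a
positive vector preserves them. -/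
theorem Balanced.vecMul_C {a : Fin 4 → ℝ} (h : Balanced a) (n : ℕ) : Balanced (a ᵥ* C n) := by
  have h0 := h.pos 0
  have h1 := h.pos 1
  have h2 := h.pos 2
  have h3 := h.pos 3
  have hn : (0 : ℝ) ≤ n := Nat.cast_nonneg n
  have m1 := mul_nonneg hn h1.le
  have m2 := mul_nonneg hn h2.le
  have m3 := mul_nonneg hn h3.le
  have m4 := mul_nonneg hn m2
  constructor
  · intro i
    fin_cases i <;>
      simp only [Fin.zero_eta, Fin.mk_one, Fin.reduceFinMk, vecMul_C_zero, vecMul_C_one,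
        vecMul_C_two, vecMul_C_three] <;> positivity
  all_goals simp only [vecMul_C_zero, vecMul_C_one, vecMul_C_two, vecMul_C_three]; nlinarith

/-- Row 2 carries the dominant weight of column `j`, so the ratio of `u` to `a` there is at least a
fifth of the old ratio at index 2. Column 3 is excluded because its entry in row 2 vanishes. -/
theorem Balanced.vecMul_C_mul_le {a u : Fin 4 → ℝ} (h : Balanced a) (hu : ∀ i, 0 ≤ u i)
    {n : ℕ} (hn : 1 ≤ n) {j : Fin 4} (hj : j ≠ 3) :
    (a ᵥ* C n) j * u 2 ≤ 5 * a 2 * (u ᵥ* C n) j := by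
  -- The pivot `c` is the entry `C n 2 j`. The tightest case for the constant 5 is `n = 1`, `j = 0`,
  -- where balance gives the bound `9 * a 2` against `5 * 2 * a 2`.
  obtain ⟨c, hc, h₁, h₂⟩ : ∃ c : ℝ, 0 ≤ c ∧ (a ᵥ* C n) j ≤ 5 * a 2 * c ∧
      c * u 2 ≤ (u ᵥ* C n) j := by
    have hn' : (1 : ℝ) ≤ n := by exact_mod_cast hn
    have h2 := h.pos 2
    have a0 := h.zero_le_two
    have a1 := h.one_le_two
    have a3 := h.three_le_two
    have u0 := hu 0
    have u1 := hu 1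
    have u2 := hu 2
    have u3 := hu 3
    have n0 : (0 : ℝ) ≤ n := by linarith
    have m1 := mul_le_mul_of_nonneg_left a1 n0
    have m3 := mul_le_mul_of_nonneg_left a3 n0
    have m4 := mul_le_mul_of_nonneg_right hn' h2.le
    have m5 := mul_le_mul_of_nonneg_left m4 n0
    fin_cases j
    · refine ⟨n + 1, by positivity, ?_, ?_⟩
      · simp only [Fin.zero_eta, vecMul_C_zero]; nlinarith
      · simp only [Fin.zero_eta, vecMul_C_zero]; nlinarith
    · refine ⟨(n + 1) * (n + 2), by positivity, ?_, ?_⟩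
      · simp only [Fin.mk_one, vecMul_C_one]; nlinarith
      · simp only [Fin.mk_one, vecMul_C_one]
        have := mul_nonneg n0 u1
        have := mul_nonneg n0 u3
        nlinarith
    · refine ⟨n ^ 2 + 2 * n + 2, by positivity, ?_, ?_⟩
      · simp only [Fin.reduceFinMk, vecMul_C_two]; nlinarith
      · simp only [Fin.reduceFinMk, vecMul_C_two]
        have := mul_nonneg n0 u1
        have := mul_nonneg n0 u3
        nlinarith
    · exact absurd rfl hj
  calc (a ᵥ* C n) j * u 2 ≤ 5 * a 2 * c * u 2 := mul_le_mul_of_nonneg_right h₁ (hu 2)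
    _ = 5 * a 2 * (c * u 2) := by ring
    _ ≤ _ := mul_le_mul_of_nonneg_left h₂ (by have := h.pos 2; positivity)

/-- The uncontrolled index 3 is charged to index 1: `a 3 ≤ a 1`, and row 3 of `C n` is at most twice
row 1. This gives the factor 3 = 1 + 2. -/
theorem Balanced.mul_vecMul_C_le {a u : Fin 4 → ℝ} (h : Balanced a) {c : ℝ} (hc : 0 ≤ c)
    (hu : ∀ i, i ≠ 3 → c * a i ≤ u i) (hu3 : 0 ≤ u 3) (n : ℕ) (j : Fin 4) :
    c * (a ᵥ* C n) j ≤ 3 * (u ᵥ* C n) j := by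
  have n0 : (0 : ℝ) ≤ n := Nat.cast_nonneg n
  have u0 := hu 0 (by decide)
  have u1 := hu 1 (by decide)
  have u2 := hu 2 (by decide)
  have a0 := mul_nonneg hc (h.pos 0).le
  have a1 := mul_nonneg hc (h.pos 1).le
  have a2 := mul_nonneg hc (h.pos 2).le
  have a31 := mul_le_mul_of_nonneg_left (h.three_le_two.trans h.two_le_one) hc
  have k1 := mul_le_mul_of_nonneg_left u1 n0
  have k2 := mul_le_mul_of_nonneg_left u2 n0
  have k22 := mul_le_mul_of_nonneg_left k2 n0
  have k3 := mul_nonneg n0 hu3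
  have l1 := mul_nonneg n0 a1
  have l2 := mul_nonneg n0 a2
  have l22 := mul_nonneg n0 l2
  have l31 := mul_le_mul_of_nonneg_left a31 n0
  fin_cases j
  · simp only [Fin.zero_eta, vecMul_C_zero]; nlinarith
  · simp only [Fin.mk_one, vecMul_C_one]; nlinarith
  · simp only [Fin.reduceFinMk, vecMul_C_two]; nlinarith
  · simp only [Fin.reduceFinMk, vecMul_C_three]; nlinarith

/-! ### Column sums of `H n` and ratios of linear forms over its columns -/

theorem vecMul_H_succ (f : Fin 4 → ℝ) (n : ℕ) : f ᵥ* H (n + 1) = (f ᵥ* H n) ᵥ* C (n + 1) := by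
  rw [H, vecMul_vecMul]

theorem balanced_vecMul_H (n : ℕ) : Balanced (1 ᵥ* H n) := by
  induction n with
  | zero => constructor <;> simp [H]
  | succ n ih => rw [vecMul_H_succ]; exact ih.vecMul_C _

/-- Every column of `C n` has sum at least 4, with equality in column 3. The bound later makes the
intervals of level `n` short. -/
theorem four_pow_le_vecMul_H (n : ℕ) (j : Fin 4) : (4 : ℝ) ^ n ≤ (1 ᵥ* H n) j := by
  induction n generalizing j with
  | zero => simp [H]
  | succ n ih =>
    rw [vecMul_H_succ]
    have h0 := ih 0
    have h1 := ih 1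
    have h2 := ih 2
    have h3 := ih 3
    have h4 : (0 : ℝ) < 4 ^ n := by positivity
    have n0 : (0 : ℝ) ≤ (n + 1 : ℕ) := Nat.cast_nonneg _
    rw [pow_succ]
    have m1 := mul_nonneg n0 (h4.le.trans h1)
    have m2 := mul_nonneg n0 (h4.le.trans h2)
    have m3 := mul_nonneg n0 (h4.le.trans h3)
    have m4 := mul_nonneg n0 m2
    fin_cases j <;>
      simp only [Fin.zero_eta, Fin.mk_one, Fin.reduceFinMk, vecMul_C_zero, vecMul_C_one,
        vecMul_C_two, vecMul_C_three] <;> nlinarith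

theorem vecMul_nonneg_of_nonneg {a : Fin 4 → ℝ} (ha : ∀ i, 0 ≤ a i) (n : ℕ) (j : Fin 4) :
    0 ≤ (a ᵥ* C n) j := by
  simp only [vecMul, dotProduct]
  exact Finset.sum_nonneg fun i _ => mul_nonneg (ha i) (C_nonneg n i j)

/-- The first step spreads the ratio at column 2 to columns 0, 1, 2 at the cost of a factor 5, and
the second to all columns at the cost of a factor 3. -/
theorem vecMul_H_add_two_ge {f : Fin 4 → ℝ} {n : ℕ} (hf : ∀ i, 0 ≤ (f ᵥ* H n) i) (j : Fin 4) :
    (f ᵥ* H n) 2 / (1 ᵥ* H n) 2 / 15 * (1 ᵥ* H (n + 2)) j ≤ (f ᵥ* H (n + 2)) j := by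
  have hb := balanced_vecMul_H n
  have h2 := hb.pos 2
  have key := (balanced_vecMul_H (n + 1)).mul_vecMul_C_le (u := f ᵥ* H (n + 1))
    (c := (f ᵥ* H n) 2 / (1 ᵥ* H n) 2 / 5) (by have := hf 2; positivity) ?_ ?_ (n + 2) j
  · rw [← vecMul_H_succ, ← vecMul_H_succ] at key
    linarith
  · intro i hi
    have := hb.vecMul_C_mul_le hf (n := n + 1) (by omega) hi
    rw [← vecMul_H_succ, ← vecMul_H_succ] at this
    rw [div_div, div_mul_eq_mul_div, div_le_iff₀ (by positivity)]
    linarith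
  · rw [vecMul_H_succ]
    exact vecMul_nonneg_of_nonneg hf _ _

/-- The ratios of a linear form to the coordinate sum on the columns of `H n` lie in
`[lo, hi]`. -/
def RatioBounds (f : Fin 4 → ℝ) (n : ℕ) (lo hi : ℝ) : Prop :=
  ∀ j, lo * (1 ᵥ* H n) j ≤ (f ᵥ* H n) j ∧ (f ᵥ* H n) j ≤ hi * (1 ᵥ* H n) j

/-- Applied to the nonnegative forms `f - lo • 1` and `hi • 1 - f`, the previous bound moves both
ends by 1/15 of their distance to the same point `p`, the ratio at column 2. -/
theorem RatioBounds.contract {f : Fin 4 → ℝ} {n : ℕ} {lo hi : ℝ} (h : RatioBounds f n lo hi) :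
    ∃ lo' hi', hi' - lo' = 14 / 15 * (hi - lo) ∧ RatioBounds f (n + 2) lo' hi' := by
  have hp : (f ᵥ* H n) 2 / (1 ᵥ* H n) 2 * (1 ᵥ* H n) 2 = (f ᵥ* H n) 2 :=
    div_mul_cancel₀ _ ((balanced_vecMul_H n).pos 2).ne'
  have h2 := (balanced_vecMul_H n).pos 2
  set p := (f ᵥ* H n) 2 / (1 ᵥ* H n) 2 with hpdef
  refine ⟨lo + (p - lo) / 15, hi - (hi - p) / 15, by ring, fun j => ⟨?_, ?_⟩⟩
  · have := vecMul_H_add_two_ge (f := f - lo • 1) (n := n)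
      (fun i => by simpa [sub_vecMul, smul_vecMul] using (h i).1) j
    simp only [sub_vecMul, smul_vecMul, Pi.sub_apply, Pi.smul_apply, smul_eq_mul, sub_div,
      mul_div_cancel_right₀ _ h2.ne', ← hpdef] at this
    linarith
  · have := vecMul_H_add_two_ge (f := hi • 1 - f) (n := n)
      (fun i => by simpa [sub_vecMul, smul_vecMul] using (h i).2) j
    simp only [sub_vecMul, smul_vecMul, Pi.sub_apply, Pi.smul_apply, smul_eq_mul, sub_div,
      mul_div_cancel_right₀ _ h2.ne', ← hpdef] at this
    linarith

theorem exists_ratioBounds (i : Fin 4) (k : ℕ) :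
    ∃ lo hi, hi - lo = (14 / 15 : ℝ) ^ k ∧ RatioBounds (Pi.single i 1) (2 * k) lo hi := by
  induction k with
  | zero =>
    refine ⟨0, 1, by simp, fun j => ?_⟩
    simp only [H, vecMul_one, Pi.one_apply, mul_one, Pi.single_apply]
    split_ifs <;> simp
  | succ k ih =>
    obtain ⟨lo, hi, h, hb⟩ := ih
    obtain ⟨lo', hi', h', hb'⟩ := hb.contract
    exact ⟨lo', hi', by rw [h', h, pow_succ'] , hb'⟩

/-! ### Projective action -/

theorem projMap_mul {m : ℕ} (A B : Matrix (Fin m) (Fin m) ℝ) {v : Fin m → ℝ}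
    (h : ∑ i, (B *ᵥ v) i ≠ 0) : projMap (A * B) v = projMap A (projMap B v) := by
  simp only [projMap, ← mulVec_mulVec, mulVec_smul, Pi.smul_apply, smul_eq_mul,
    ← Finset.mul_sum, mul_inv, inv_inv, smul_smul]
  congr 1
  field_simp

theorem projMap_mem_openSimplex {m : ℕ} [NeZero m] {M : Matrix (Fin m) (Fin m) ℝ} {v : Fin m → ℝ}
    (h : ∀ i, 0 < (M *ᵥ v) i) : projMap M v ∈ openSimplex m := by
  have hs : 0 < ∑ i, (M *ᵥ v) i := Finset.sum_pos (fun i _ => h i) Finset.univ_nonempty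
  refine ⟨fun i => ?_, ?_⟩
  · have := h i
    simp only [projMap, Pi.smul_apply, smul_eq_mul]
    positivity
  · simp only [projMap, Pi.smul_apply, smul_eq_mul, ← Finset.mul_sum]
    exact inv_mul_cancel₀ hs.ne'

theorem projMap_mem_stdSimplex {m : ℕ} {M : Matrix (Fin m) (Fin m) ℝ} {v : Fin m → ℝ}
    (h : ∀ i, 0 ≤ (M *ᵥ v) i) (hs : 0 < ∑ i, (M *ᵥ v) i) :
    projMap M v ∈ stdSimplex ℝ (Fin m) := by
  refine ⟨fun i => ?_, ?_⟩
  · have := h i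
    simp only [projMap, Pi.smul_apply, smul_eq_mul]
    positivity
  · simp only [projMap, Pi.smul_apply, smul_eq_mul, ← Finset.mul_sum]
    exact inv_mul_cancel₀ hs.ne'

theorem openSimplex_subset_stdSimplex (m : ℕ) : openSimplex m ⊆ stdSimplex ℝ (Fin m) :=
  fun _ h => ⟨fun i => (h.1 i).le, h.2⟩

theorem mulVec_C_zero (n : ℕ) (v : Fin 4 → ℝ) : (C n *ᵥ v) 0 = ∑ i, v i := by
  simp [mulVec, dotProduct, C_zero_row]

theorem mulVec_C_nonneg (n : ℕ) {v : Fin 4 → ℝ} (hv : ∀ i, 0 ≤ v i) (i : Fin 4) :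
    0 ≤ (C n *ᵥ v) i := by
  simp only [mulVec, dotProduct]
  exact Finset.sum_nonneg fun j _ => mul_nonneg (C_nonneg n i j) (hv j)

theorem sum_mulVec_C_pos (n : ℕ) {v : Fin 4 → ℝ} (hv : v ∈ stdSimplex ℝ (Fin 4)) :
    0 < ∑ i, (C n *ᵥ v) i := by
  refine Finset.sum_pos' (fun i _ => mulVec_C_nonneg n hv.1 i) ⟨0, Finset.mem_univ _, ?_⟩
  rw [mulVec_C_zero, hv.2]
  exact one_pos

theorem mulVec_C_pos (n : ℕ) {v : Fin 4 → ℝ} (hv : ∀ i, 0 < v i) (i : Fin 4) :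
    0 < (C n *ᵥ v) i := by
  have h0 := hv 0
  have h1 := hv 1
  have h2 := hv 2
  have h3 := hv 3
  rw [C_eq]
  fin_cases i <;> simp [mulVec, dotProduct, Fin.sum_univ_four] <;> positivity

theorem mulVec_C_mul_C_pos (m n : ℕ) {v : Fin 4 → ℝ} (hv : v ∈ stdSimplex ℝ (Fin 4)) (i : Fin 4) :
    0 < ((C m * C n) *ᵥ v) i := by
  obtain ⟨j, -, hj⟩ : ∃ j ∈ Finset.univ, 0 < v j := by
    refine Finset.exists_lt_of_sum_lt (f := fun _ => (0 : ℝ)) ?_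
    simp [hv.2]
  exact Finset.sum_pos' (fun k _ => mul_nonneg (C_mul_C_pos m n i k).le (hv.1 k))
    ⟨j, Finset.mem_univ _, mul_pos (C_mul_C_pos m n i j) hj⟩

theorem sum_mulVec_H (n : ℕ) (v : Fin 4 → ℝ) : ∑ i, (H n *ᵥ v) i = (1 ᵥ* H n) ⬝ᵥ v := by
  rw [← dotProduct_mulVec, one_dotProduct]

theorem sum_mulVec_H_pos (n : ℕ) {v : Fin 4 → ℝ} (hv : v ∈ stdSimplex ℝ (Fin 4)) :
    0 < ∑ i, (H n *ᵥ v) i := by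
  have h1 : ∑ i, v i ≤ (1 ᵥ* H n) ⬝ᵥ v := by
    refine Finset.sum_le_sum fun i _ => le_mul_of_one_le_left (hv.1 i) ?_
    exact (one_le_pow₀ (by norm_num)).trans (four_pow_le_vecMul_H n i)
  rw [sum_mulVec_H]
  linarith [hv.2]

theorem antitone_image_stdSimplex :
    Antitone fun n : ℕ => projMap (H n) '' stdSimplex ℝ (Fin 4) := by
  refine antitone_nat_of_succ_le fun n => ?_
  rintro _ ⟨v, hv, rfl⟩
  have hs := sum_mulVec_C_pos (n + 1) hv
  exact ⟨_, projMap_mem_stdSimplex (mulVec_C_nonneg (n + 1) hv.1) hs,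
    (projMap_mul (H n) (C (n + 1)) hs.ne').symm⟩

theorem antitone_image_openSimplex :
    Antitone fun n : ℕ => projMap (H n) '' openSimplex 4 := by
  refine antitone_nat_of_succ_le fun n => ?_
  rintro _ ⟨v, hv, rfl⟩
  have hs := sum_mulVec_C_pos (n + 1) (openSimplex_subset_stdSimplex 4 hv)
  exact ⟨_, projMap_mem_openSimplex (mulVec_C_pos (n + 1) hv.1),
    (projMap_mul (H n) (C (n + 1)) hs.ne').symm⟩

/-- The extra factor `C (n + 1) * C (n + 2)` is positive, so it sends the closed simplex into the
open one. -/
theorem image_stdSimplex_subset_image_openSimplex (n : ℕ) :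
    projMap (H (n + 2)) '' stdSimplex ℝ (Fin 4) ⊆ projMap (H n) '' openSimplex 4 := by
  rintro _ ⟨v, hv, rfl⟩
  have hpos := mulVec_C_mul_C_pos (n + 1) (n + 2) hv
  refine ⟨_, projMap_mem_openSimplex hpos, ?_⟩
  rw [← projMap_mul _ _ (Finset.sum_pos (fun i _ => hpos i) Finset.univ_nonempty).ne',
    ← mul_assoc]
  rfl

theorem iInter_image_openSimplex :
    (⋂ n : ℕ, projMap (H n) '' openSimplex 4) =
      ⋂ n : ℕ, projMap (H n) '' stdSimplex ℝ (Fin 4) := by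
  refine subset_antisymm
    (Set.iInter_mono fun n => Set.image_mono (openSimplex_subset_stdSimplex 4))
    (Set.subset_iInter fun n => ?_)
  exact (Set.iInter_subset _ (n + 2)).trans (image_stdSimplex_subset_image_openSimplex n)

/-- The coordinate is an average of the column ratios, with weights proportional to `(1 ᵥ* H n) j *
v j`. -/
theorem RatioBounds.projMap_mem_Icc {i : Fin 4} {n : ℕ} {lo hi : ℝ}
    (h : RatioBounds (Pi.single i 1) n lo hi) {v : Fin 4 → ℝ} (hv : v ∈ stdSimplex ℝ (Fin 4)) :
    projMap (H n) v i ∈ Set.Icc lo hi := by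
  have hs := sum_mulVec_H_pos n hv
  have hi : (H n *ᵥ v) i = (Pi.single i 1 ᵥ* H n) ⬝ᵥ v := by
    rw [← dotProduct_mulVec, single_dotProduct, one_mul]
  simp only [projMap, Pi.smul_apply, smul_eq_mul, inv_mul_eq_div]
  rw [Set.mem_Icc, le_div_iff₀ hs, div_le_iff₀ hs, sum_mulVec_H, hi, ← smul_eq_mul,
    ← smul_eq_mul, ← smul_dotProduct, ← smul_dotProduct]
  exact ⟨Finset.sum_le_sum fun j _ => mul_le_mul_of_nonneg_right (h j).1 (hv.1 j),
    Finset.sum_le_sum fun j _ => mul_le_mul_of_nonneg_right (h j).2 (hv.1 j)⟩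

theorem exists_iInter_image_stdSimplex_eq_singleton :
    ∃ lam0 : Fin 4 → ℝ,
      (⋂ n : ℕ, projMap (H n) '' stdSimplex ℝ (Fin 4)) = {lam0} := by
  have hne : (⋂ n : ℕ, projMap (H n) '' stdSimplex ℝ (Fin 4)).Nonempty := by
    have hc : ∀ n, IsCompact (projMap (H n) '' stdSimplex ℝ (Fin 4)) := by
      intro n
      refine (isCompact_stdSimplex ℝ (Fin 4)).image_of_continuousOn ?_
      have hcont : Continuous fun v : Fin 4 → ℝ => H n *ᵥ v := by fun_prop
      refine ContinuousOn.smul (ContinuousOn.inv₀ ?_ fun v hv => (sum_mulVec_H_pos n hv).ne')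
        hcont.continuousOn
      exact (continuous_finsetSum _ fun i _ => (continuous_apply i).comp hcont).continuousOn
    refine IsCompact.nonempty_iInter_of_sequence_nonempty_isCompact_isClosed _
      (fun n => antitone_image_stdSimplex n.le_succ) (fun n => ?_) (hc 0) fun n => (hc n).isClosed
    exact ⟨_, Pi.single 0 1, single_mem_stdSimplex ℝ 0, rfl⟩
  obtain ⟨u, hu⟩ := hne
  refine ⟨u, subset_antisymm (fun v hv => ?_) (Set.singleton_subset_iff.2 hu)⟩
  rw [Set.mem_singleton_iff]
  rw [Set.mem_iInter] at hu hv
  ext i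
  -- Both points lie in the image of level `2 * k`, where each coordinate ranges over an interval of
  -- length `(14 / 15) ^ k`.
  refine eq_of_abs_sub_le_all fun ε hε => ?_
  obtain ⟨k, hk⟩ := exists_pow_lt_of_lt_one hε (by norm_num : (14 / 15 : ℝ) < 1)
  obtain ⟨lo, hi, hd, hb⟩ := exists_ratioBounds i k
  obtain ⟨u', hu', rfl⟩ := hu (2 * k)
  obtain ⟨v', hv', rfl⟩ := hv (2 * k)
  have h₁ := hb.projMap_mem_Icc hu'
  have h₂ := hb.projMap_mem_Icc hv'
  rw [abs_le]
  constructor <;> linarith [h₁.1, h₁.2, h₂.1, h₂.2]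

/-! ### Systems of interval translations -/

/-- Finitely many intervals `[left i, left i + len i)`, each with a translation by `shift i`. -/
structure IntervalSystem (ι : Type*) where
  left : ι → ℝ
  len : ι → ℝ
  shift : ι → ℝ

namespace IntervalSystem

variable {ι : Type*}

def interval (S : IntervalSystem ι) (i : ι) : Set ℝ := Set.Ico (S.left i) (S.left i + S.len i)

def dom (S : IntervalSystem ι) : Set ℝ := ⋃ i, S.interval i

def Step (S : IntervalSystem ι) (x y : ℝ) : Prop := ∃ i, x ∈ S.interval i ∧ y = x + S.shift i

/-- `y` lies on the forward orbit of `x`. -/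
def Reach (S : IntervalSystem ι) : ℝ → ℝ → Prop := Relation.ReflTransGen S.Step

/-- The increments of `F` are invariant under the translations of the system. -/
def Inv (S : IntervalSystem ι) (F : ℝ → ℝ) : Prop :=
  ∀ i a b, S.left i ≤ a → a ≤ b → b ≤ S.left i + S.len i →
    F (b + S.shift i) - F (a + S.shift i) = F b - F a

def increment (S : IntervalSystem ι) (F : ℝ → ℝ) (i : ι) : ℝ :=
  F (S.left i + S.len i) - F (S.left i)

theorem mem_dom {S : IntervalSystem ι} {x : ℝ} : x ∈ S.dom ↔ ∃ i, x ∈ S.interval i :=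
  Set.mem_iUnion

theorem reach_shift {S : IntervalSystem ι} {i : ι} {x : ℝ} (h : x ∈ S.interval i) :
    S.Reach x (x + S.shift i) :=
  Relation.ReflTransGen.single ⟨i, h, rfl⟩

theorem Reach.refl {S : IntervalSystem ι} (x : ℝ) : S.Reach x x := Relation.ReflTransGen.refl

theorem Reach.trans {S : IntervalSystem ι} {x y z : ℝ} (h : S.Reach x y) (h' : S.Reach y z) :
    S.Reach x z := Relation.ReflTransGen.trans h h'

/-- `S'` is a system of first returns of `S`, with return matrix `M`. -/
structure Induces [Fintype ι] (S : IntervalSystem ι) (M : Matrix ι ι ℝ) (S' : IntervalSystem ι) :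
    Prop where
  nonneg : ∀ i j, 0 ≤ M i j
  reach : ∀ x y, S'.Step x y → S.Reach x y
  enters : ∀ x ∈ S.dom, ∃ y ∈ S'.dom, S.Reach x y
  visits : ∀ i j, 0 < M i j → ∀ x ∈ S'.interval j, ∃ y ∈ S.interval i, S.Reach x y
  covers : ∀ i, ∀ y ∈ S.interval i, ∃ j τ, y - τ ∈ S'.interval j ∧
    ∀ z ∈ S'.interval j, z + τ ∈ S.interval i ∧ S.Reach z (z + τ)
  inv : ∀ F, S.Inv F → S'.Inv F
  increment_eq : ∀ F, S.Inv F → S.increment F = M *ᵥ S'.increment F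

theorem one_add_single_pos [DecidableEq ι] {w l i j : ι}
    (h : 0 < (1 + Matrix.single w l (1 : ℝ)) i j) :
    i = j ∨ (i = w ∧ j = l) := by
  by_contra! hcon
  rw [Matrix.add_apply, Matrix.one_apply_ne hcon.1, Matrix.single_apply_of_ne] at h
  · simp at h
  · rintro ⟨rfl, rfl⟩
    exact hcon.2 rfl rfl

theorem one_add_single_nonneg [DecidableEq ι] (w l i j : ι) :
    0 ≤ (1 + Matrix.single w l (1 : ℝ)) i j := by
  rw [Matrix.add_apply, Matrix.one_apply, Matrix.single_apply]
  split_ifs <;> norm_num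

variable [Fintype ι]

theorem Induces.reach_of_reach {S S' : IntervalSystem ι} {M : Matrix ι ι ℝ} (h : S.Induces M S')
    {x y : ℝ} (hxy : S'.Reach x y) : S.Reach x y := by
  induction hxy with
  | refl => exact Reach.refl x
  | tail _ h₂ ih => exact ih.trans (h.reach _ _ h₂)

theorem Induces.refl [DecidableEq ι] (S : IntervalSystem ι) : S.Induces 1 S where
  nonneg i j := by rw [Matrix.one_apply]; split_ifs <;> simp
  reach _ _ h := Relation.ReflTransGen.single h
  enters x hx := ⟨x, hx, Reach.refl x⟩
  visits i j hij x hx := by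
    rw [Matrix.one_apply] at hij
    split_ifs at hij with h
    · exact ⟨x, h ▸ hx, Reach.refl x⟩
    · exact absurd hij (lt_irrefl 0)
  covers i y hy := ⟨i, 0, by simpa using hy, fun z hz => by
    rw [add_zero]
    exact ⟨hz, Reach.refl z⟩⟩
  inv _ h := h
  increment_eq _ _ := (one_mulVec _).symm

theorem Induces.trans {S S' S'' : IntervalSystem ι} {M M' : Matrix ι ι ℝ}
    (h : S.Induces M S') (h' : S'.Induces M' S'') : S.Induces (M * M') S'' where
  nonneg i j := Finset.sum_nonneg fun k _ => mul_nonneg (h.nonneg i k) (h'.nonneg k j)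
  reach x y hxy := h.reach_of_reach (h'.reach x y hxy)
  enters x hx := by
    obtain ⟨y, hy, hxy⟩ := h.enters x hx
    obtain ⟨z, hz, hyz⟩ := h'.enters y hy
    exact ⟨z, hz, hxy.trans (h.reach_of_reach hyz)⟩
  visits i j hij x hx := by
    obtain ⟨k, hk⟩ : ∃ k, 0 < M i k * M' k j := by
      by_contra! hcon
      exact hij.not_ge (Finset.sum_nonpos fun k _ => hcon k)
    have h₁ : 0 < M i k := (h.nonneg i k).lt_of_ne fun e => by simp [← e] at hk
    have h₂ : 0 < M' k j := (h'.nonneg k j).lt_of_ne fun e => by simp [← e] at hk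
    obtain ⟨y, hy, hxy⟩ := h'.visits k j h₂ x hx
    obtain ⟨z, hz, hyz⟩ := h.visits i k h₁ y hy
    exact ⟨z, hz, (h.reach_of_reach hxy).trans hyz⟩
  covers i y hy := by
    obtain ⟨k, τ, hk, hτ⟩ := h.covers i y hy
    obtain ⟨j, σ, hj, hσ⟩ := h'.covers k _ hk
    refine ⟨j, σ + τ, by rwa [add_comm, ← sub_sub], fun z hz => ?_⟩
    have h₁ := hσ z hz
    have h₂ := hτ _ h₁.1
    rw [← add_assoc]
    exact ⟨h₂.1, (h.reach_of_reach h₁.2).trans h₂.2⟩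
  inv F hF := h'.inv F (h.inv F hF)
  increment_eq F hF := by
    rw [h.increment_eq F hF, h'.increment_eq F (h.inv F hF), mulVec_mulVec]

variable [DecidableEq ι]

theorem one_add_single_mulVec (w l : ι) (v : ι → ℝ) (i : ι) :
    ((1 + Matrix.single w l (1 : ℝ)) *ᵥ v) i = v i + if i = w then v l else 0 := by
  rw [add_mulVec, one_mulVec, Matrix.single_mulVec, Pi.add_apply, Function.update_apply]
  simp

/-- Cutting the image of the right part of the interval `w`, which is the interval `l`. -/
theorem induces_of_cut_image {S S' : IntervalSystem ι} {w l : ι} (hwl : w ≠ l)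
    (hpos : ∀ i, 0 ≤ S'.len i) (hlen : ∀ i, i ≠ w → S.len i = S'.len i)
    (hlen_w : S.len w = S'.len w + S'.len l) (hleft : ∀ i, i ≠ l → S'.left i = S.left i)
    (hleft_l : S'.left l = S.left w + S'.len w) (hshift : ∀ i, i ≠ l → S'.shift i = S.shift i)
    (hshift_l : S'.shift l = S.shift w + S.shift l)
    (himage : S.left l = S.left w + S'.len w + S.shift w)
    (henter : ∀ x ∈ S.interval l, x + S.shift l ∈ S'.dom) :
    S.Induces (1 + Matrix.single w l 1) S' := by
  have hlen_l := hlen l hwl.symm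
  have hleft_w := hleft w hwl
  have hw := hpos w
  have hl := hpos l
  have sub_of_ne : ∀ i, i ≠ l → S'.interval i ⊆ S.interval i := by
    intro i hi x hx
    simp only [interval, Set.mem_Ico, hleft i hi] at hx ⊢
    by_cases h : i = w
    · subst h; constructor <;> linarith
    · rwa [hlen i h]
  have sub_l : S'.interval l ⊆ S.interval w := by
    intro x hx
    simp only [interval, Set.mem_Ico] at hx ⊢
    constructor <;> linarith
  have map_l : ∀ x ∈ S'.interval l, x + S.shift w ∈ S.interval l := by
    intro x hx
    simp only [interval, Set.mem_Ico] at hx ⊢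
    constructor <;> linarith
  have eq_of_ne : ∀ i, i ≠ l → i ≠ w → S'.interval i = S.interval i := by
    intro i h₁ h₂
    rw [interval, interval, hleft i h₁, hlen i h₂]
  have split_w : ∀ x ∈ S.interval w, x ∈ S'.interval w ∨ x ∈ S'.interval l := by
    intro x hx
    simp only [interval, Set.mem_Ico] at hx ⊢
    rcases lt_or_ge x (S'.left w + S'.len w) with h | h
    · left; constructor <;> linarith
    · right; constructor <;> linarith
  refine ⟨one_add_single_nonneg w l, ?_, ?_, ?_, ?_, ?_, ?_⟩
  · rintro x y ⟨i, hx, rfl⟩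
    by_cases hi : i = l
    · subst hi
      rw [hshift_l, ← add_assoc]
      exact (reach_shift (sub_l hx)).trans (reach_shift (map_l x hx))
    · rw [hshift i hi]
      exact reach_shift (sub_of_ne i hi hx)
  · intro x hx
    obtain ⟨i, hi⟩ := mem_dom.1 hx
    by_cases h₁ : i = l
    · subst h₁
      exact ⟨_, henter x hi, reach_shift hi⟩
    · refine ⟨x, mem_dom.2 ?_, Reach.refl x⟩
      by_cases h₂ : i = w
      · subst h₂
        rcases split_w x hi with h | h <;> exact ⟨_, h⟩
      · exact ⟨i, by rwa [eq_of_ne i h₁ h₂]⟩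
  · intro i j hij x hx
    rcases one_add_single_pos hij with rfl | ⟨rfl, rfl⟩
    · by_cases h₁ : i = l
      · subst h₁
        exact ⟨_, map_l x hx, reach_shift (sub_l hx)⟩
      · exact ⟨x, sub_of_ne i h₁ hx, Reach.refl x⟩
    · exact ⟨x, sub_l hx, Reach.refl x⟩
  · intro i y hy
    by_cases h₁ : i = l
    · subst h₁
      refine ⟨i, S.shift w, ?_, fun z hz => ⟨map_l z hz, reach_shift (sub_l hz)⟩⟩
      simp only [interval, Set.mem_Ico] at hy ⊢
      constructor <;> linarith
    · by_cases h₂ : i = w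
      · subst h₂
        rcases split_w y hy with h | h
        · exact ⟨i, 0, by simpa using h, fun z hz => by
            rw [add_zero]; exact ⟨sub_of_ne i h₁ hz, Reach.refl z⟩⟩
        · exact ⟨l, 0, by simpa using h, fun z hz => by
            rw [add_zero]; exact ⟨sub_l hz, Reach.refl z⟩⟩
      · exact ⟨i, 0, by simpa [eq_of_ne i h₁ h₂] using hy, fun z hz => by
          rw [add_zero]; exact ⟨sub_of_ne i h₁ hz, Reach.refl z⟩⟩
  · intro F hF i a b ha hab hb
    by_cases h₁ : i = l
    · subst h₁
      have e₁ := hF w a b (by linarith) hab (by linarith)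
      have e₂ := hF i (a + S.shift w) (b + S.shift w) (by linarith) (by linarith) (by linarith)
      rw [hshift_l, ← add_assoc, ← add_assoc, e₂, e₁]
    · rw [hshift i h₁]
      rw [hleft i h₁] at ha hb
      refine hF i a b ha hab (hb.trans ?_)
      by_cases h₂ : i = w
      · subst h₂; linarith
      · rw [hlen i h₂]
  · intro F hF
    ext i
    rw [one_add_single_mulVec]
    simp only [increment]
    by_cases h₁ : i = l
    · subst h₁
      -- The old interval `l` is the translate by `S.shift w` of the new one, so invariance of `F`
      -- equates their increments.
      have e := hF w (S'.left i) (S'.left i + S'.len i) (by linarith) (by linarith) (by linarith)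
      rw [if_neg hwl.symm, add_zero, ← e, himage, hlen_l, hleft_l]
      ring_nf
    · rw [hleft i h₁]
      by_cases h₂ : i = w
      · subst h₂
        rw [if_pos rfl, hlen_w, hleft_l, ← add_assoc]
        ring
      · rw [if_neg h₂, hlen i h₂, add_zero]

/-- Cutting the right part of the interval `w`, which is the image of the interval `l`. -/
theorem induces_of_cut_interval {S S' : IntervalSystem ι} {w l : ι} (hwl : w ≠ l)
    (hpos : ∀ i, 0 ≤ S'.len i) (hlen : ∀ i, i ≠ w → S.len i = S'.len i)
    (hlen_w : S.len w = S'.len w + S'.len l) (hleft : ∀ i, S'.left i = S.left i)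
    (hshift : ∀ i, i ≠ l → S'.shift i = S.shift i)
    (hshift_l : S'.shift l = S.shift l + S.shift w)
    (himage : S.left l + S.shift l = S.left w + S'.len w)
    (henter : ∀ x ∈ S.interval w, S.left w + S'.len w ≤ x → x + S.shift w ∈ S'.dom) :
    S.Induces (1 + Matrix.single w l 1) S' := by
  have hlen_l := hlen l hwl.symm
  have hleft_w := hleft w
  have hleft_l := hleft l
  have hw := hpos w
  have hl := hpos l
  have sub : ∀ i, S'.interval i ⊆ S.interval i := by
    intro i x hx
    simp only [interval, Set.mem_Ico, hleft i] at hx ⊢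
    by_cases h : i = w
    · subst h; constructor <;> linarith
    · rwa [hlen i h]
  have map_l : ∀ x ∈ S.interval l, x + S.shift l ∈ S.interval w := by
    intro x hx
    simp only [interval, Set.mem_Ico] at hx ⊢
    constructor <;> linarith
  have eq_of_ne : ∀ i, i ≠ w → S'.interval i = S.interval i := by
    intro i h₂
    rw [interval, interval, hleft i, hlen i h₂]
  have split_w : ∀ x ∈ S.interval w, x ∈ S'.interval w ∨ S.left w + S'.len w ≤ x := by
    intro x hx
    simp only [interval, Set.mem_Ico] at hx ⊢
    rcases lt_or_ge x (S'.left w + S'.len w) with h | h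
    · left; constructor <;> linarith
    · right; linarith
  refine ⟨one_add_single_nonneg w l, ?_, ?_, ?_, ?_, ?_, ?_⟩
  · rintro x y ⟨i, hx, rfl⟩
    by_cases hi : i = l
    · subst hi
      rw [hshift_l, ← add_assoc]
      exact (reach_shift (sub i hx)).trans (reach_shift (map_l x (sub i hx)))
    · rw [hshift i hi]
      exact reach_shift (sub i hx)
  · intro x hx
    obtain ⟨i, hi⟩ := mem_dom.1 hx
    by_cases h₂ : i = w
    · subst h₂
      rcases split_w x hi with h | h
      · exact ⟨x, mem_dom.2 ⟨_, h⟩, Reach.refl x⟩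
      · exact ⟨_, henter x hi h, reach_shift hi⟩
    · exact ⟨x, mem_dom.2 ⟨i, by rwa [eq_of_ne i h₂]⟩, Reach.refl x⟩
  · intro i j hij x hx
    rcases one_add_single_pos hij with rfl | ⟨rfl, rfl⟩
    · exact ⟨x, sub i hx, Reach.refl x⟩
    · exact ⟨_, map_l x (sub j hx), reach_shift (sub j hx)⟩
  · intro i y hy
    by_cases h₂ : i = w
    · subst h₂
      rcases split_w y hy with h | h
      · exact ⟨i, 0, by simpa using h, fun z hz => by
          rw [add_zero]; exact ⟨sub i hz, Reach.refl z⟩⟩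
      · refine ⟨l, S.shift l, ?_, fun z hz =>
          ⟨map_l z (sub l hz), reach_shift (sub l hz)⟩⟩
        simp only [interval, Set.mem_Ico] at hy ⊢
        constructor <;> linarith
    · exact ⟨i, 0, by simpa [eq_of_ne i h₂] using hy, fun z hz => by
        rw [add_zero]; exact ⟨sub i hz, Reach.refl z⟩⟩
  · intro F hF i a b ha hab hb
    by_cases h₁ : i = l
    · subst h₁
      have e₁ := hF i a b (by linarith) hab (by linarith)
      have e₂ := hF w (a + S.shift i) (b + S.shift i) (by linarith) (by linarith) (by linarith)
      rw [hshift_l, ← add_assoc, ← add_assoc, e₂, e₁]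
    · rw [hshift i h₁]
      rw [hleft i] at ha hb
      refine hF i a b ha hab (hb.trans ?_)
      by_cases h₂ : i = w
      · subst h₂; linarith
      · rw [hlen i h₂]
  · intro F hF
    ext i
    rw [one_add_single_mulVec]
    simp only [increment]
    rw [hleft i]
    by_cases h₂ : i = w
    · subst h₂
      -- The part cut off from `w` is the translate of `l` by `S.shift l`, so it contributes the
      -- increment of `l`.
      have e := hF l (S'.left l) (S'.left l + S'.len l) (by linarith) (by linarith) (by linarith)
      rw [if_pos rfl, hlen_w, ← e, hleft_l, add_right_comm (S.left l), himage, ← add_assoc]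
      ring
    · rw [if_neg h₂, hlen i h₂, add_zero]

end IntervalSystem

/-! ### Rauzy induction -/

theorem insertPerm_symm_apply {d : ℕ} (k i : Fin (d + 1)) :
    (insertPerm k).symm i = if i ≤ k then i
      else if h : i.val = d then ⟨min (k.val + 1) d, by omega⟩ else ⟨i.val + 1, by omega⟩ := rfl

theorem insertPerm_symm_lt_symm {d : ℕ} {k i j : Fin (d + 1)} (hi : i ≠ Fin.last d)
    (hj : j ≠ Fin.last d) : (insertPerm k).symm i < (insertPerm k).symm j ↔ i < j := by
  have hi' : i.val ≠ d := fun h => hi (Fin.ext h)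
  have hj' : j.val ≠ d := fun h => hj (Fin.ext h)
  simp only [insertPerm_symm_apply, hi', hj', dif_neg, not_false_eq_true]
  split_ifs with h₁ h₂ h₂ <;> simp only [Fin.lt_def, Fin.le_def] at * <;> omega

theorem insertPerm_symm_last_lt_symm {d : ℕ} {k j : Fin (d + 1)} (hk : k ≠ Fin.last d)
    (hj : j ≠ Fin.last d) :
    (insertPerm k).symm (Fin.last d) < (insertPerm k).symm j ↔ k < j := by
  have hk' : k.val ≠ d := fun h => hk (Fin.ext h)
  have hj' : j.val ≠ d := fun h => hj (Fin.ext h)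
  have hl : ¬ Fin.last d ≤ k := by simp only [Fin.le_def, Fin.val_last]; omega
  simp only [insertPerm_symm_apply, hj', hl, dif_neg, not_false_eq_true, if_false,
    Fin.val_last, dif_pos]
  split_ifs with h₁ <;> simp only [Fin.lt_def, Fin.le_def] at * <;> omega

theorem insertPerm_symm_lt_symm_last {d : ℕ} {k i : Fin (d + 1)} (hk : k ≠ Fin.last d)
    (hi : i ≠ Fin.last d) :
    (insertPerm k).symm i < (insertPerm k).symm (Fin.last d) ↔ i ≤ k := by
  have hk' : k.val ≠ d := fun h => hk (Fin.ext h)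
  have hi' : i.val ≠ d := fun h => hi (Fin.ext h)
  have hl : ¬ Fin.last d ≤ k := by simp only [Fin.le_def, Fin.val_last]; omega
  simp only [insertPerm_symm_apply, hi', hl, dif_neg, not_false_eq_true, if_false,
    Fin.val_last, dif_pos]
  split_ifs with h₁ <;> simp only [Fin.lt_def, Fin.le_def] at * <;> omega

/-! ### Endpoints of intervals as partial sums along a row -/

section OrderSum

variable {d : ℕ} (p : Equiv.Perm (Fin (d + 1))) (lam : Fin (d + 1) → ℝ)

/-- The total length of the intervals placed to the left of `i` in the ordering `p`. -/
def orderSum (i : Fin (d + 1)) : ℝ := ∑ j with p⁻¹ j < p⁻¹ i, lam j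

variable {lam}

theorem orderSum_nonneg (h : ∀ i, 0 ≤ lam i) (i : Fin (d + 1)) : 0 ≤ orderSum p lam i :=
  Finset.sum_nonneg fun j _ => h j

theorem orderSum_add (i : Fin (d + 1)) :
    orderSum p lam i + lam i = ∑ j with p⁻¹ j ≤ p⁻¹ i, lam j := by
  have : ({j | p⁻¹ j ≤ p⁻¹ i} : Finset (Fin (d + 1))) =
      insert i ({j | p⁻¹ j < p⁻¹ i} : Finset (Fin (d + 1))) := by
    ext j
    simp [le_iff_eq_or_lt]
  rw [this, Finset.sum_insert (by simp), add_comm, orderSum]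

theorem orderSum_add_le (h : ∀ i, 0 ≤ lam i) (i : Fin (d + 1)) :
    orderSum p lam i + lam i ≤ ∑ j, lam j := by
  rw [orderSum_add]
  exact Finset.sum_le_univ_sum_of_nonneg h

theorem orderSum_add_le_orderSum (h : ∀ i, 0 ≤ lam i) {i j : Fin (d + 1)} (hij : p⁻¹ i < p⁻¹ j) :
    orderSum p lam i + lam i ≤ orderSum p lam j := by
  rw [orderSum_add]
  refine Finset.sum_le_sum_of_subset_of_nonneg (fun k => ?_) fun k _ _ => h k
  simp only [Finset.mem_filter, Finset.mem_univ, true_and]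
  exact fun hk => hk.trans_lt hij

theorem orderSum_last_add {l : Fin (d + 1)} (hl : p (Fin.last d) = l) :
    orderSum p lam l + lam l = ∑ j, lam j := by
  rw [orderSum_add, ← hl]
  congr 1
  ext j
  simp [Fin.le_last]

theorem orderSum_first (hd : 0 < d + 1) : orderSum p lam (p ⟨0, hd⟩) = 0 := by
  rw [orderSum]
  refine Finset.sum_eq_zero fun j hj => ?_
  simp at hj

theorem orderSum_succ {k : ℕ} (hk : k + 1 < d + 1) :
    orderSum p lam (p ⟨k + 1, hk⟩) =
      orderSum p lam (p ⟨k, by omega⟩) + lam (p ⟨k, by omega⟩) := by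
  rw [orderSum_add, orderSum]
  refine Finset.sum_congr ?_ fun _ _ => rfl
  ext j
  simp [Fin.lt_def, Fin.le_def]

theorem exists_orderSum_le_lt {y : ℝ} (h0 : 0 ≤ y) (h1 : y < ∑ j, lam j) :
    ∃ i, orderSum p lam i ≤ y ∧ y < orderSum p lam i + lam i := by
  have key : ∀ k : ℕ, ∀ hk : k < d + 1, y < orderSum p lam (p ⟨k, hk⟩) + lam (p ⟨k, hk⟩) →
      ∃ i, orderSum p lam i ≤ y ∧ y < orderSum p lam i + lam i := by
    intro k
    induction k with
    | zero => exact fun hk h => ⟨_, (orderSum_first p hk).trans_le h0, h⟩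
    | succ k ih =>
      intro hk h
      by_cases hy : orderSum p lam (p ⟨k + 1, hk⟩) ≤ y
      · exact ⟨_, hy, h⟩
      · exact ih (by omega) (by rw [← orderSum_succ p hk]; exact not_le.1 hy)
  exact key d (Nat.lt_succ_self d) (h1.trans_eq (orderSum_last_add p rfl).symm)

theorem iUnion_Ico_orderSum (h : ∀ i, 0 ≤ lam i) :
    ⋃ i, Set.Ico (orderSum p lam i) (orderSum p lam i + lam i) = Set.Ico 0 (∑ i, lam i) := by
  refine subset_antisymm (Set.iUnion_subset fun i =>
    Set.Ico_subset_Ico (orderSum_nonneg p h i) (orderSum_add_le p h i)) fun y hy => ?_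
  exact Set.mem_iUnion.2 (exists_orderSum_le_lt p hy.1 hy.2)

theorem pairwise_disjoint_Ico_orderSum (h : ∀ i, 0 ≤ lam i) :
    Pairwise (Function.onFun Disjoint
      fun i => Set.Ico (orderSum p lam i) (orderSum p lam i + lam i)) := by
  intro i j hij
  refine Set.disjoint_left.2 fun y hi hj => ?_
  rcases lt_or_gt_of_ne (fun e => hij (p⁻¹.injective e)) with hlt | hlt
  · exact absurd (orderSum_add_le_orderSum p h hlt) (by linarith [hi.2, hj.1])
  · exact absurd (orderSum_add_le_orderSum p h hlt) (by linarith [hj.2, hi.1])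

/-- Telescoping along the row: the right endpoint of each interval is the left endpoint of the next.
-/
theorem apply_orderSum_of_increments {F : ℝ → ℝ} {m : Fin (d + 1) → ℝ}
    (h : ∀ i, F (orderSum p lam i + lam i) - F (orderSum p lam i) = m i) (i : Fin (d + 1)) :
    F (orderSum p lam i) = F 0 + orderSum p m i := by
  have key : ∀ k : ℕ, ∀ hk : k < d + 1,
      F (orderSum p lam (p ⟨k, hk⟩)) = F 0 + orderSum p m (p ⟨k, hk⟩) := by
    intro k
    induction k with
    | zero => intro hk; rw [orderSum_first, orderSum_first, add_zero]
    | succ k ih =>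
      intro hk
      rw [orderSum_succ, orderSum_succ]
      linarith [h (p ⟨k, by omega⟩), ih (by omega)]
  simpa using key (p⁻¹ i).val (p⁻¹ i).isLt

theorem sum_increments {F : ℝ → ℝ} {m : Fin (d + 1) → ℝ}
    (h : ∀ i, F (orderSum p lam i + lam i) - F (orderSum p lam i) = m i) :
    F (∑ i, lam i) - F 0 = ∑ i, m i := by
  rw [← orderSum_last_add p (lam := lam) rfl, ← orderSum_last_add p (lam := m) rfl]
  linarith [h (p (Fin.last d)), apply_orderSum_of_increments p h (p (Fin.last d))]

theorem orderSum_eq_ite (i : Fin (d + 1)) :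
    orderSum p lam i = ∑ j, if p⁻¹ j < p⁻¹ i then lam j else 0 := Finset.sum_filter _ _

variable {p} {lam' : Fin (d + 1) → ℝ} {w l : Fin (d + 1)}

theorem orderSum_eq_of_last (hlam : ∀ i, lam i = lam' i + if i = w then lam' l else 0)
    (hw : p (Fin.last d) = w) (i : Fin (d + 1)) : orderSum p lam' i = orderSum p lam i := by
  rw [orderSum, orderSum]
  refine Finset.sum_congr rfl fun j hj => ?_
  rw [hlam, if_neg, add_zero]
  rintro rfl
  rw [Finset.mem_filter, ← hw] at hj
  simp [(Fin.le_last _).not_gt] at hj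

/-- The new row has the block `w l` where the old row has `w`, and the block has the old length of
`w`. All other names keep their place. -/
theorem orderSum_mul_insertPerm_of_ne
    (hlam : ∀ i, lam i = lam' i + if i = w then lam' l else 0) (hl : p (Fin.last d) = l)
    (hwl : w ≠ l) {i : Fin (d + 1)} (hi : i ≠ l) :
    orderSum (p * insertPerm (p⁻¹ w)) lam' i = orderSum p lam i := by
  have ne_last : ∀ j, j ≠ l → p⁻¹ j ≠ Fin.last d := fun j hj h => hj (by rw [← hl, ← h]; simp)
  have hl' : p⁻¹ l = Fin.last d := by rw [← hl]; simp
  have h₁ : ∀ j, (if (p * insertPerm (p⁻¹ w))⁻¹ j < (p * insertPerm (p⁻¹ w))⁻¹ i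
      then lam' j else 0) = (if p⁻¹ j < p⁻¹ i then lam' j else 0) +
        if j = l then (if p⁻¹ w < p⁻¹ i then lam' l else 0) else 0 := by
    intro j
    simp only [_root_.mul_inv_rev, Equiv.Perm.mul_apply]
    by_cases hj : j = l
    · subst hj
      have e : (insertPerm (p⁻¹ w))⁻¹ (p⁻¹ j) < (insertPerm (p⁻¹ w))⁻¹ (p⁻¹ i) ↔
          p⁻¹ w < p⁻¹ i := by
        rw [hl']
        exact insertPerm_symm_last_lt_symm (ne_last w hwl) (ne_last i hi)
      simp only [e, if_true]
      rw [hl', if_neg (Fin.le_last _).not_gt, zero_add]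
    · have e : (insertPerm (p⁻¹ w))⁻¹ (p⁻¹ j) < (insertPerm (p⁻¹ w))⁻¹ (p⁻¹ i) ↔
          p⁻¹ j < p⁻¹ i := insertPerm_symm_lt_symm (ne_last j hj) (ne_last i hi)
      simp only [e, hj, if_false, add_zero]
  have h₂ : ∀ j, (if p⁻¹ j < p⁻¹ i then lam j else 0) =
      (if p⁻¹ j < p⁻¹ i then lam' j else 0) +
        if j = w then (if p⁻¹ w < p⁻¹ i then lam' l else 0) else 0 := by
    intro j
    rw [hlam]
    by_cases hj : j = w
    · subst hj
      split_ifs <;> simp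
    · simp [hj]
  simp only [orderSum_eq_ite, h₁, h₂, Finset.sum_add_distrib, Finset.sum_ite_eq',
    Finset.mem_univ, if_true]

theorem orderSum_mul_insertPerm_last
    (hlam : ∀ i, lam i = lam' i + if i = w then lam' l else 0) (hl : p (Fin.last d) = l)
    (hwl : w ≠ l) :
    orderSum (p * insertPerm (p⁻¹ w)) lam' l = orderSum p lam w + lam' w := by
  have ne_last : ∀ j, j ≠ l → p⁻¹ j ≠ Fin.last d := fun j hj h => hj (by rw [← hl, ← h]; simp)
  have hl' : p⁻¹ l = Fin.last d := by rw [← hl]; simp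
  have h₁ : ∀ j, (if (p * insertPerm (p⁻¹ w))⁻¹ j < (p * insertPerm (p⁻¹ w))⁻¹ l
      then lam' j else 0) = (if p⁻¹ j < p⁻¹ w then lam j else 0) +
        if j = w then lam' w else 0 := by
    intro j
    by_cases hj : j = l
    · subst hj
      rw [if_neg (lt_irrefl _), hl', if_neg (Fin.le_last _).not_gt, if_neg hwl.symm, zero_add]
    · have e : (p * insertPerm (p⁻¹ w))⁻¹ j < (p * insertPerm (p⁻¹ w))⁻¹ l ↔
          p⁻¹ j ≤ p⁻¹ w := by
        simp only [_root_.mul_inv_rev, Equiv.Perm.mul_apply]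
        rw [hl']
        exact insertPerm_symm_lt_symm_last (ne_last w hwl) (ne_last j hj)
      simp only [e]
      by_cases hjw : j = w
      · subst hjw
        simp
      · have : p⁻¹ j ≠ p⁻¹ w := fun h => hjw (p⁻¹.injective h)
        simp [hjw, hlam, le_iff_lt_or_eq]
  simp only [orderSum_eq_ite, h₁, Finset.sum_add_distrib, Finset.sum_ite_eq',
    Finset.mem_univ, if_true]

theorem sum_eq_sum_add (hlam : ∀ i, lam i = lam' i + if i = w then lam' l else 0) :
    ∑ i, lam i = ∑ i, lam' i + lam' l := by
  simp [hlam, Finset.sum_add_distrib]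

end OrderSum

/-- The interval exchange given by a marked permutation and lengths indexed by names. -/
def MarkedPerm.system {d : ℕ} (x : MarkedPerm d) (lam : Fin (d + 1) → ℝ) :
    IntervalSystem (Fin (d + 1)) where
  left := orderSum x.top lam
  len := lam
  shift i := orderSum x.bot lam i - orderSum x.top lam i

theorem MarkedPerm.dom_system {d : ℕ} (x : MarkedPerm d) {lam : Fin (d + 1) → ℝ}
    (h : ∀ i, 0 ≤ lam i) : (x.system lam).dom = Set.Ico 0 (∑ i, lam i) :=
  iUnion_Ico_orderSum x.top h

theorem MarkedPerm.mem_dom_system {d : ℕ} (x : MarkedPerm d) {lam : Fin (d + 1) → ℝ}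
    (h : ∀ i, 0 ≤ lam i) {y : ℝ} : y ∈ (x.system lam).dom ↔ 0 ≤ y ∧ y < ∑ i, lam i := by
  rw [x.dom_system h, Set.mem_Ico]

/-- The interval of `α`, last in the top row, and the image of the interval of `β`, last in the
bottom row, both end at the total length. For the move `a` the second is longer, so the interval of
`α` is the image of the right part of that of `β`. For `b` the first is longer, and the image of the
interval of `β` is the right part of that of `α`. In both cases a segment of the loser's length is
cut off at the right end, and the next step from it leads back into the shorter domain. -/
theorem MarkedPerm.system_induces_move {d : ℕ} (x : MarkedPerm d)
    (hx : x.top (Fin.last d) ≠ x.bot (Fin.last d)) (c : Move) {lam' : Fin (d + 1) → ℝ}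
    (hpos : ∀ i, 0 ≤ lam' i) :
    (x.system (x.moveMatrix c *ᵥ lam')).Induces (x.moveMatrix c) ((x.move c).system lam') := by
  set lam := x.moveMatrix c *ᵥ lam' with hlamdef
  set α := x.top (Fin.last d) with hα
  set β := x.bot (Fin.last d) with hβ
  cases c with
  | a =>
    have hlam : ∀ i, lam i = lam' i + if i = β then lam' α else 0 :=
      IntervalSystem.one_add_single_mulVec β α lam'
    have hlamβ : lam β = lam' β + lam' α := by simp [hlam]
    have hlamα : lam α = lam' α := by simp [hlam, hx]
    have htop : ∀ i, i ≠ α → orderSum (x.move .a).top lam' i = orderSum x.top lam i :=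
      fun i hi => orderSum_mul_insertPerm_of_ne hlam hα.symm hx.symm hi
    have htop_l : orderSum (x.move .a).top lam' α = orderSum x.top lam β + lam' β :=
      orderSum_mul_insertPerm_last hlam hα.symm hx.symm
    have hbot : ∀ i, orderSum (x.move .a).bot lam' i = orderSum x.bot lam i :=
      orderSum_eq_of_last hlam hβ.symm
    have hsum : ∑ i, lam i = ∑ i, lam' i + lam' α := sum_eq_sum_add hlam
    have hlastα : orderSum x.top lam α + lam α = ∑ i, lam i := orderSum_last_add x.top hα.symm
    have hlastβ : orderSum x.bot lam β + lam β = ∑ i, lam i := orderSum_last_add x.bot hβ.symm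
    refine IntervalSystem.induces_of_cut_image hx.symm hpos (fun i hi => ?_) hlamβ htop htop_l
      (fun i hi => ?_) ?_ ?_ fun y hy => ?_
    · exact (hlam i).trans (by rw [if_neg hi, add_zero]; rfl)
    · simp only [MarkedPerm.system, htop i hi, hbot]
    · simp only [MarkedPerm.system, hbot]
      rw [htop_l]
      linarith
    · simp only [MarkedPerm.system]
      linarith
    · rw [(x.move .a).mem_dom_system hpos]
      simp only [IntervalSystem.interval, MarkedPerm.system, Set.mem_Ico] at hy ⊢
      have h0 := orderSum_nonneg (x.move .a).bot hpos α
      have h1 := orderSum_add_le (x.move .a).bot hpos α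
      rw [hbot] at h0 h1
      constructor <;> linarith [hy.1, hy.2]
  | b =>
    have hlam : ∀ i, lam i = lam' i + if i = α then lam' β else 0 :=
      IntervalSystem.one_add_single_mulVec α β lam'
    have hlamα : lam α = lam' α + lam' β := by simp [hlam]
    have hlamβ : lam β = lam' β := by simp [hlam, hx.symm]
    have hbot : ∀ i, i ≠ β → orderSum (x.move .b).bot lam' i = orderSum x.bot lam i :=
      fun i hi => orderSum_mul_insertPerm_of_ne hlam hβ.symm hx hi
    have hbot_l : orderSum (x.move .b).bot lam' β = orderSum x.bot lam α + lam' α :=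
      orderSum_mul_insertPerm_last hlam hβ.symm hx
    have htop : ∀ i, orderSum (x.move .b).top lam' i = orderSum x.top lam i :=
      orderSum_eq_of_last hlam hα.symm
    have hsum : ∑ i, lam i = ∑ i, lam' i + lam' β := sum_eq_sum_add hlam
    have hlastα : orderSum x.top lam α + lam α = ∑ i, lam i := orderSum_last_add x.top hα.symm
    have hlastβ : orderSum x.bot lam β + lam β = ∑ i, lam i := orderSum_last_add x.bot hβ.symm
    refine IntervalSystem.induces_of_cut_interval hx hpos (fun i hi => ?_) hlamα htop
      (fun i hi => ?_) ?_ ?_ fun y hy hy' => ?_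
    · exact (hlam i).trans (by rw [if_neg hi, add_zero]; rfl)
    · simp only [MarkedPerm.system, hbot i hi, htop]
    · simp only [MarkedPerm.system, htop]
      rw [hbot_l]
      linarith
    · simp only [MarkedPerm.system]
      linarith
    · rw [(x.move .b).mem_dom_system hpos]
      simp only [IntervalSystem.interval, MarkedPerm.system, Set.mem_Ico] at hy hy' ⊢
      have h0 := orderSum_nonneg (x.move .b).bot hpos β
      have h1 := orderSum_add_le (x.move .b).bot hpos β
      rw [hbot_l] at h0 h1
      have h2 := orderSum_nonneg x.bot (lam := lam) (fun i => by
        rw [hlam]; have := hpos i; have := hpos β; split_ifs <;> linarith) α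
      have h3 := hpos α
      constructor <;> linarith [hy.1, hy.2]

/-- The end of the path that starts at a marked permutation and follows a word. -/
def MarkedPerm.path {d : ℕ} (x : MarkedPerm d) (w : List Move) : MarkedPerm d :=
  w.foldl MarkedPerm.move x

/-- The last names of the two rows differ all along the path. -/
def MarkedPerm.Admissible {d : ℕ} : MarkedPerm d → List Move → Prop
  | _, [] => True
  | x, c :: w => x.top (Fin.last d) ≠ x.bot (Fin.last d) ∧ (x.move c).Admissible w

theorem MarkedPerm.moveMatrix_nonneg {d : ℕ} (x : MarkedPerm d) (c : Move) (i j : Fin (d + 1)) :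
    0 ≤ x.moveMatrix c i j := by
  cases c <;> exact IntervalSystem.one_add_single_nonneg _ _ i j

theorem MarkedPerm.pathMatrix_nonneg {d : ℕ} (x : MarkedPerm d) (w : List Move)
    (i j : Fin (d + 1)) : 0 ≤ x.pathMatrix w i j := by
  induction w generalizing x i with
  | nil => rw [MarkedPerm.pathMatrix, Matrix.one_apply]; split_ifs <;> simp
  | cons c w ih =>
    rw [MarkedPerm.pathMatrix, Matrix.mul_apply]
    exact Finset.sum_nonneg fun k _ => mul_nonneg (x.moveMatrix_nonneg c i k) (ih _ k)

theorem MarkedPerm.system_induces_path {d : ℕ} (x : MarkedPerm d) (w : List Move)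
    (hw : x.Admissible w) {lam' : Fin (d + 1) → ℝ} (hpos : ∀ i, 0 ≤ lam' i) :
    (x.system (x.pathMatrix w *ᵥ lam')).Induces (x.pathMatrix w) ((x.path w).system lam') := by
  induction w generalizing x with
  | nil =>
    rw [MarkedPerm.pathMatrix, one_mulVec]
    exact IntervalSystem.Induces.refl _
  | cons c w ih =>
    rw [MarkedPerm.pathMatrix, ← mulVec_mulVec]
    refine (x.system_induces_move hw.1 c fun i => ?_).trans (ih (x.move c) hw.2)
    simp only [mulVec, dotProduct]
    exact Finset.sum_nonneg fun j _ => mul_nonneg (pathMatrix_nonneg _ _ _ _) (hpos j)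

/-! ### The two words as admissible closed paths at `pi0` -/

theorem MarkedPerm.path_append {d : ℕ} (x : MarkedPerm d) (v w : List Move) :
    x.path (v ++ w) = (x.path v).path w := List.foldl_append

theorem MarkedPerm.path_replicate {d : ℕ} {x : MarkedPerm d} {c : Move} (h : x.move c = x)
    (n : ℕ) : x.path (List.replicate n c) = x := by
  induction n with
  | zero => rfl
  | succ n ih => rw [List.replicate_succ]; change (x.move c).path _ = x; rw [h, ih]

theorem MarkedPerm.admissible_append {d : ℕ} {x : MarkedPerm d} {v w : List Move}
    (hv : x.Admissible v) (hw : (x.path v).Admissible w) : x.Admissible (v ++ w) := by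
  induction v generalizing x with
  | nil => exact hw
  | cons c v ih => exact ⟨hv.1, ih hv.2 hw⟩

theorem MarkedPerm.admissible_replicate {d : ℕ} {x : MarkedPerm d} {c : Move} (h : x.move c = x)
    (hx : x.top (Fin.last d) ≠ x.bot (Fin.last d)) (n : ℕ) :
    x.Admissible (List.replicate n c) := by
  induction n with
  | zero => trivial
  | succ n ih => exact ⟨hx, by rwa [h]⟩

theorem path_wordA (n : ℕ) : pi0.path (wordA n) = pi0 := by
  rw [wordA, MarkedPerm.path_append, MarkedPerm.path_append]
  change MarkedPerm.path (((pi0.move .b).move .a).path (List.replicate n .b)) _ = pi0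
  rw [MarkedPerm.path_replicate move_bab]
  exact move_baabb

theorem path_wordB (n : ℕ) : pi0.path (wordB n) = pi0 := by
  rw [wordB, MarkedPerm.path_append, MarkedPerm.path_append]
  change MarkedPerm.path (((pi0.move .a).move .b).path (List.replicate n .a)) _ = pi0
  rw [MarkedPerm.path_replicate move_aba]
  exact move_abbaa

theorem admissible_wordA (n : ℕ) : pi0.Admissible (wordA n) := by
  refine MarkedPerm.admissible_append (MarkedPerm.admissible_append
    ⟨by decide, by decide, trivial⟩ (MarkedPerm.admissible_replicate move_bab (by decide) n)) ?_
  rw [MarkedPerm.path_append]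
  change (MarkedPerm.path ((pi0.move .b).move .a) _).Admissible _
  rw [MarkedPerm.path_replicate move_bab]
  exact ⟨by decide, by decide, by decide, trivial⟩

theorem admissible_wordB (n : ℕ) : pi0.Admissible (wordB n) := by
  refine MarkedPerm.admissible_append (MarkedPerm.admissible_append
    ⟨by decide, by decide, trivial⟩ (MarkedPerm.admissible_replicate move_aba (by decide) n)) ?_
  rw [MarkedPerm.path_append]
  change (MarkedPerm.path ((pi0.move .a).move .b) _).Admissible _
  rw [MarkedPerm.path_replicate move_aba]
  exact ⟨by decide, by decide, by decide, trivial⟩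

theorem system_induces_C (n : ℕ) {lam' : Fin 4 → ℝ} (hpos : ∀ i, 0 ≤ lam' i) :
    (pi0.system (C n *ᵥ lam')).Induces (C n) (pi0.system lam') := by
  have h := pi0.system_induces_path (wordA n ++ wordB n)
    (MarkedPerm.admissible_append (admissible_wordA n)
      (by rw [path_wordA]; exact admissible_wordB n)) hpos
  rwa [MarkedPerm.path_append, path_wordA, path_wordB] at h

theorem system_induces_H (n : ℕ) {lam' : Fin 4 → ℝ} (hpos : ∀ i, 0 ≤ lam' i) :
    (pi0.system (H n *ᵥ lam')).Induces (H n) (pi0.system lam') := by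
  induction n generalizing lam' with
  | zero =>
    rw [H, one_mulVec]
    exact IntervalSystem.Induces.refl _
  | succ n ih =>
    rw [H, ← mulVec_mulVec]
    exact (ih (mulVec_C_nonneg (n + 1) hpos)).trans (system_induces_C (n + 1) hpos)

/-! ### The interval exchange map -/

section Iet

variable {d : ℕ} {x : MarkedPerm d} {lam : Fin (d + 1) → ℝ}

theorem leftEnd_eq_orderSum (hx : x.top = 1) (i : Fin (d + 1)) :
    leftEnd lam i = orderSum x.top lam i := by
  simp [leftEnd, orderSum, hx]

theorem imageLeftEnd_eq_orderSum (hx : x.top = 1) (i : Fin (d + 1)) :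
    imageLeftEnd lam x.perm i = orderSum x.bot lam i := by
  simp [imageLeftEnd, orderSum, MarkedPerm.perm, hx]

theorem iet_apply_of_mem (hx : x.top = 1) (h : ∀ i, 0 ≤ lam i) {i : Fin (d + 1)} {y : ℝ}
    (hy : y ∈ (x.system lam).interval i) :
    iet lam x.perm y = y + (x.system lam).shift i := by
  have hsub : ∀ j, subinterval lam j = (x.system lam).interval j := fun j => by
    simp only [subinterval, IntervalSystem.interval, leftEnd_eq_orderSum hx, MarkedPerm.system]
  rw [iet, Finset.sum_eq_single i]
  · rw [hsub, Set.indicator_of_mem hy, leftEnd_eq_orderSum hx, imageLeftEnd_eq_orderSum hx]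
    rfl
  · intro j _ hj
    rw [hsub, Set.indicator_of_notMem]
    exact fun hj' => Set.disjoint_left.1 (pairwise_disjoint_Ico_orderSum x.top h hj) hj' hy
  · exact fun hi => absurd (Finset.mem_univ i) hi

theorem domain_eq_dom (h : ∀ i, 0 ≤ lam i) : domain lam = (x.system lam).dom :=
  (x.dom_system h).symm

theorem exists_iterate_of_reach (hx : x.top = 1) (h : ∀ i, 0 ≤ lam i) {y z : ℝ}
    (hyz : (x.system lam).Reach y z) : ∃ n : ℕ, (iet lam x.perm)^[n] y = z := by
  induction hyz with
  | refl => exact ⟨0, rfl⟩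
  | tail _ h₂ ih =>
    obtain ⟨n, rfl⟩ := ih
    obtain ⟨i, hi, rfl⟩ := h₂
    exact ⟨n + 1, by rw [Function.iterate_succ_apply', iet_apply_of_mem hx h hi]⟩

theorem measurable_iet {m : ℕ} (lam : Fin m → ℝ) (p : Equiv.Perm (Fin m)) :
    Measurable (iet lam p) :=
  measurable_id.add (Finset.measurable_sum _ fun _ _ =>
    measurable_const.indicator measurableSet_Ico)

/-- The domain is tiled by the intervals in the top order and by their images in the bottom order,
and the map translates each tile onto its image. -/
theorem measurePreserving_iet_restrict (hx : x.top = 1) (h : ∀ i, 0 ≤ lam i) :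
    MeasurePreserving (iet lam x.perm) (volume.restrict (domain lam))
      (volume.restrict (domain lam)) := by
  refine ⟨measurable_iet _ _, ?_⟩
  have h₁ : volume.restrict (domain lam) =
      Measure.sum fun i => volume.restrict ((x.system lam).interval i) := by
    rw [domain_eq_dom (x := x) h]
    exact Measure.restrict_iUnion (pairwise_disjoint_Ico_orderSum x.top h)
      fun i => measurableSet_Ico
  have h₂ : volume.restrict (domain lam) = Measure.sum fun i =>
      volume.restrict (Set.Ico (orderSum x.bot lam i) (orderSum x.bot lam i + lam i)) := by
    rw [domain, ← iUnion_Ico_orderSum x.bot h]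
    exact Measure.restrict_iUnion (pairwise_disjoint_Ico_orderSum x.bot h)
      fun i => measurableSet_Ico
  conv_lhs => rw [h₁]
  rw [h₂, Measure.map_sum (measurable_iet _ _).aemeasurable]
  congr 1
  ext1 i
  have hpre : (· + (x.system lam).shift i) ⁻¹'
      Set.Ico (orderSum x.bot lam i) (orderSum x.bot lam i + lam i) =
      (x.system lam).interval i := by
    rw [Set.preimage_add_const_Ico]
    simp only [IntervalSystem.interval, MarkedPerm.system]
    congr 1 <;> ring
  have hmp := (measurePreserving_add_right volume ((x.system lam).shift i)).restrict_preimage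
    (s := Set.Ico (orderSum x.bot lam i) (orderSum x.bot lam i + lam i)) measurableSet_Ico
  rw [hpre] at hmp
  rw [← hmp.map_eq]
  refine Measure.map_congr ?_
  filter_upwards [ae_restrict_mem (measurableSet_Ico :
    MeasurableSet ((x.system lam).interval i))] with y hy
  exact iet_apply_of_mem hx h hy

variable {μ : Measure ℝ} [IsProbabilityMeasure μ]

theorem measureReal_Iio_sub (μ : Measure ℝ) [IsProbabilityMeasure μ] {a b : ℝ} (hab : a ≤ b) :
    μ.real (Set.Iio b) - μ.real (Set.Iio a) = μ.real (Set.Ico a b) := by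
  rw [← Set.Iio_union_Ico_eq_Iio hab, measureReal_union _ measurableSet_Ico]
  · ring
  · exact Set.disjoint_left.2 fun y hy hy' => hy'.1.not_gt hy

/-- For `[a, b)` inside one interval, the preimage of its translate is `[a, b)` itself up to a null
set, because the images of the other intervals are disjoint from the image of this one. -/
theorem inv_measureReal_Iio (hx : x.top = 1) (h : ∀ i, 0 ≤ lam i) (hμ : μ (domain lam)ᶜ = 0)
    (hT : MeasurePreserving (iet lam x.perm) μ μ) :
    (x.system lam).Inv fun y => μ.real (Set.Iio y) := by
  intro i a b ha hab hb
  simp only [measureReal_Iio_sub μ (add_le_add_left hab _), measureReal_Iio_sub μ hab]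
  rw [← hT.measureReal_preimage measurableSet_Ico.nullMeasurableSet]
  refine measureReal_congr ?_
  have hae : ∀ᵐ y ∂μ, y ∈ domain lam := hμ
  filter_upwards [hae] with y hy
  rw [domain_eq_dom (x := x) h] at hy
  obtain ⟨j, hj⟩ := IntervalSystem.mem_dom.1 hy
  refine propext ?_
  change iet lam x.perm y ∈ Set.Ico (a + _) (b + _) ↔ y ∈ Set.Ico a b
  rw [iet_apply_of_mem hx h hj]
  by_cases hij : j = i
  · subst hij
    simp only [Set.mem_Ico, add_le_add_iff_right, add_lt_add_iff_right]
  · refine iff_of_false (fun hy' => ?_) fun hy' => ?_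
    · have hdisj := Set.disjoint_left.1 (pairwise_disjoint_Ico_orderSum x.bot h hij)
      refine @hdisj (y + (x.system lam).shift j) ?_ ?_
      · simp only [IntervalSystem.interval, MarkedPerm.system, Set.mem_Ico] at hj ⊢
        constructor <;> linarith [hj.1, hj.2]
      · simp only [MarkedPerm.system, Set.mem_Ico] at hy' ha hb ⊢
        constructor <;> linarith [hy'.1, hy'.2]
    · refine Set.disjoint_left.1 (pairwise_disjoint_Ico_orderSum x.top h hij) hj ?_
      simp only [MarkedPerm.system] at ha hb
      exact ⟨ha.trans hy'.1, hy'.2.trans_le hb⟩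

end Iet

/-! ### Minimality -/

theorem exists_H_mulVec_eq {lam0 : Fin 4 → ℝ}
    (h : lam0 ∈ ⋂ n : ℕ, projMap (H n) '' openSimplex 4) (n : ℕ) :
    ∃ lam' : Fin 4 → ℝ, (∀ i, 0 < lam' i) ∧ lam0 = H n *ᵥ lam' := by
  obtain ⟨v, hv, rfl⟩ := Set.mem_iInter.1 h n
  have hs := sum_mulVec_H_pos n (openSimplex_subset_stdSimplex 4 hv)
  refine ⟨(∑ i, (H n *ᵥ v) i)⁻¹ • v, fun i => ?_, ?_⟩
  · have := hv.1 i
    simp only [Pi.smul_apply, smul_eq_mul]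
    positivity
  · rw [mulVec_smul, projMap]

theorem mem_openSimplex_of_mem_iInter {lam0 : Fin 4 → ℝ}
    (h : lam0 ∈ ⋂ n : ℕ, projMap (H n) '' openSimplex 4) : lam0 ∈ openSimplex 4 := by
  obtain ⟨v, hv, rfl⟩ := Set.mem_iInter.1 h 0
  exact projMap_mem_openSimplex fun i => by rw [H, one_mulVec]; exact hv.1 i

theorem four_pow_mul_le {n : ℕ} {v : Fin 4 → ℝ} (hv : ∀ i, 0 ≤ v i) (i : Fin 4) :
    4 ^ n * v i ≤ ∑ j, (H n *ᵥ v) j := by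
  rw [sum_mulVec_H]
  refine (mul_le_mul_of_nonneg_right (four_pow_le_vecMul_H n i) (hv i)).trans ?_
  refine Finset.single_le_sum (f := fun j => (1 ᵥ* H n) j * v j) (fun j _ => ?_)
    (Finset.mem_univ i)
  exact mul_nonneg ((balanced_vecMul_H n).pos j).le (hv j)

/-- At level `n`, `y` lies in a translate, reached along orbits, of some short interval `k`. The
orbit of `x` enters the domain of level `n + 2`, and from there it visits every interval of level
`n`, in particular `k`. Following the translation then brings it close to `y`. -/
theorem exists_reach_abs_sub_lt {lam0 : Fin 4 → ℝ}
    (h : lam0 ∈ ⋂ n : ℕ, projMap (H n) '' openSimplex 4) {x y : ℝ}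
    (hx : x ∈ (pi0.system lam0).dom) (hy : y ∈ (pi0.system lam0).dom) {ε : ℝ} (hε : 0 < ε) :
    ∃ z, (pi0.system lam0).Reach x z ∧ |z - y| < ε := by
  obtain ⟨n, hn⟩ := exists_pow_lt_of_lt_one hε (by norm_num : (1 / 4 : ℝ) < 1)
  have hsum := (mem_openSimplex_of_mem_iInter h).2
  obtain ⟨v, hv, rfl⟩ := exists_H_mulVec_eq h (n + 2)
  have hH : H (n + 2) *ᵥ v = H n *ᵥ (C (n + 1) *ᵥ (C (n + 2) *ᵥ v)) := by
    simp only [mulVec_mulVec, H, mul_assoc]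
  rw [hH] at hx hy hsum ⊢
  have hv₂ := mulVec_C_pos (n + 2) hv
  have hv₁ := mulVec_C_pos (n + 1) hv₂
  have i₁ := system_induces_H n fun i => (hv₁ i).le
  have i₂ := (system_induces_C (n + 1) fun i => (hv₂ i).le).trans
    (system_induces_C (n + 2) fun i => (hv i).le)
  obtain ⟨x₁, hx₁, r₁⟩ := i₁.enters x hx
  obtain ⟨x₂, hx₂, r₂⟩ := i₂.enters x₁ hx₁
  obtain ⟨j, hj⟩ := IntervalSystem.mem_dom.1 hx₂
  obtain ⟨i, hi⟩ := IntervalSystem.mem_dom.1 hy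
  obtain ⟨k, τ, hk, hτ⟩ := i₁.covers i y hi
  obtain ⟨z, hz, r₃⟩ := i₂.visits k j (C_mul_C_pos _ _ k j) x₂ hj
  refine ⟨z + τ, (r₁.trans (i₁.reach_of_reach (r₂.trans r₃))).trans (hτ z hz).2, ?_⟩
  -- The total length is 1, so each interval of level `n` has length at most `(1 / 4) ^ n`.
  have hlen := four_pow_mul_le (n := n) (fun i => (hv₁ i).le) k
  rw [hsum, mul_comm, ← le_div_iff₀ (by positivity), ← _root_.one_div_pow] at hlen
  have hlen' : (pi0.system (C (n + 1) *ᵥ (C (n + 2) *ᵥ v))).len k < ε := hlen.trans_lt hn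
  rw [abs_lt]
  constructor <;> linarith [hz.1, hz.2, hk.1, hk.2]

theorem isMinimal_of_mem_iInter {lam0 : Fin 4 → ℝ}
    (h : lam0 ∈ ⋂ n : ℕ, projMap (H n) '' openSimplex 4) : IsMinimal lam0 pi0.perm := by
  have hpos : ∀ i, 0 ≤ lam0 i := fun i => ((mem_openSimplex_of_mem_iInter h).1 i).le
  intro x hx y hy
  rw [domain_eq_dom (x := pi0) hpos] at hx hy
  refine Metric.mem_closure_iff.2 fun ε hε => ?_
  obtain ⟨z, hz, hd⟩ := exists_reach_abs_sub_lt h hx hy hε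
  refine ⟨z, exists_iterate_of_reach rfl hpos hz, ?_⟩
  rwa [dist_comm, Real.dist_eq]

/-! ### Unique ergodicity -/

theorem isProbabilityMeasure_restrict_domain {m : ℕ} {lam : Fin m → ℝ} (h : ∑ i, lam i = 1) :
    IsProbabilityMeasure (volume.restrict (domain lam)) :=
  ⟨by simp [domain, h]⟩

/-- The increments of level `n` are nonnegative but may vanish in some coordinates, so the closed
simplices are the ones to use. Only the zero vector must be ruled out, and the total increment 1
does this. -/
theorem increment_eq_of_inv {lam0 : Fin 4 → ℝ}
    (h : (⋂ n : ℕ, projMap (H n) '' stdSimplex ℝ (Fin 4)) = {lam0}) {F : ℝ → ℝ}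
    (hmono : Monotone F) (hF : (pi0.system lam0).Inv F) (hsum : F 1 - F 0 = 1) :
    (pi0.system lam0).increment F = lam0 := by
  have hmem : lam0 ∈ ⋂ n : ℕ, projMap (H n) '' openSimplex 4 := by
    rw [iInter_image_openSimplex, h]
    exact rfl
  have htotal : ∑ i, (pi0.system lam0).increment F i = 1 := by
    rw [← sum_increments (F := F) pi0.top (lam := lam0)
      (m := (pi0.system lam0).increment F) fun i => rfl,
      (mem_openSimplex_of_mem_iInter hmem).2, hsum]
  rw [← Set.mem_singleton_iff, ← h, Set.mem_iInter]
  intro n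
  obtain ⟨v, hv, hlam⟩ := exists_H_mulVec_eq hmem n
  have hind := system_induces_H n fun i => (hv i).le
  rw [← hlam] at hind
  have hinc := hind.increment_eq F hF
  set w := (pi0.system v).increment F
  have hw : ∀ i, 0 ≤ w i := fun i =>
    sub_nonneg.2 (hmono (le_add_of_nonneg_right (hv i).le))
  have hwsum : 0 < ∑ i, w i := by
    refine (Finset.sum_nonneg fun i _ => hw i).lt_of_ne fun e => ?_
    have hw0 : w = 0 := funext fun i =>
      (Finset.sum_eq_zero_iff_of_nonneg fun i _ => hw i).1 e.symm i (Finset.mem_univ i)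
    rw [hinc, hw0, mulVec_zero] at htotal
    simp at htotal
  refine ⟨(∑ i, w i)⁻¹ • w, ⟨fun i => ?_, ?_⟩, ?_⟩
  · have := hw i
    simp only [Pi.smul_apply, smul_eq_mul]
    positivity
  · simp only [Pi.smul_apply, smul_eq_mul, ← Finset.mul_sum]
    exact inv_mul_cancel₀ hwsum.ne'
  · simp only [projMap, mulVec_smul, ← hinc, Pi.smul_apply, smul_eq_mul, ← Finset.mul_sum,
      htotal, mul_one, inv_inv, smul_smul]
    rw [mul_inv_cancel₀ hwsum.ne', one_smul]

/-- Since `F` fixes the left endpoint of each interval and of its image, invariance gives that `F u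
- u` is constant along orbits. It vanishes at 0, hence on a dense orbit, and monotonicity extends
this to all of `(0, 1)`. -/
theorem eq_self_of_inv {lam0 : Fin 4 → ℝ}
    (h : (⋂ n : ℕ, projMap (H n) '' stdSimplex ℝ (Fin 4)) = {lam0}) {F : ℝ → ℝ}
    (hmono : Monotone F) (hF : (pi0.system lam0).Inv F) (h0 : F 0 = 0) (h1 : F 1 = 1) {y : ℝ}
    (hy : y ∈ Set.Ioo (0 : ℝ) 1) : F y = y := by
  have hmem : lam0 ∈ ⋂ n : ℕ, projMap (H n) '' openSimplex 4 := by
    rw [iInter_image_openSimplex, h]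
    exact rfl
  have hlam := mem_openSimplex_of_mem_iInter hmem
  have hpos : ∀ i, 0 ≤ lam0 i := fun i => (hlam.1 i).le
  have hinc := increment_eq_of_inv h hmono hF (by rw [h0, h1, sub_zero])
  have htop : ∀ i, F (orderSum pi0.top lam0 i) = orderSum pi0.top lam0 i := fun i => by
    rw [apply_orderSum_of_increments pi0.top (m := lam0) (fun i => congrFun hinc i), h0, zero_add]
  have hbot : ∀ i, F (orderSum pi0.bot lam0 i) = orderSum pi0.bot lam0 i := fun i => by
    rw [apply_orderSum_of_increments pi0.bot (F := F) (lam := lam0) (m := lam0)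
      (fun i => ?_), h0, zero_add]
    have e := hF i ((pi0.system lam0).left i) ((pi0.system lam0).left i + lam0 i) le_rfl
      (le_add_of_nonneg_right (hpos i)) le_rfl
    have e' := congrFun hinc i
    simp only [IntervalSystem.increment, MarkedPerm.system] at e e'
    rw [add_sub_cancel, show ∀ a b c : ℝ, a + b + (c - a) = c + b by intros; ring] at e
    linarith
  have hstep : ∀ u v, (pi0.system lam0).Reach u v → F u = u → F v = v := by
    intro u v huv hu
    induction huv with
    | refl => exact hu
    | tail _ h₂ ih =>
      obtain ⟨i, hi, rfl⟩ := h₂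
      have e := hF i _ _ le_rfl hi.1 hi.2.le
      have e₁ := htop i
      have e₂ := hbot i
      simp only [MarkedPerm.system] at e ⊢
      rw [add_sub_cancel] at e
      linarith
  have hdom : ∀ z ∈ Set.Ico (0 : ℝ) 1, z ∈ (pi0.system lam0).dom := fun z hz => by
    rw [pi0.dom_system hpos, hlam.2]; exact hz
  have hdense : ∀ ε > 0, ∀ z ∈ Set.Ico (0 : ℝ) 1, ∃ u, F u = u ∧ |u - z| < ε := by
    intro ε hε z hz
    obtain ⟨u, hu, hd⟩ := exists_reach_abs_sub_lt hmem (hdom 0 (by simp)) (hdom z hz) hε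
    exact ⟨u, hstep 0 u hu h0, hd⟩
  refine le_antisymm (le_of_forall_pos_le_add fun ε hε => ?_)
    (le_of_forall_pos_le_add fun ε hε => ?_)
  -- The target `y + δ` stays below 1, and a fixed point within `δ` of it lies in `(y, y + 2 * δ)`,
  -- hence in `(y, y + ε)`.
  · set δ := min (ε / 2) ((1 - y) / 2)
    have hδ : 0 < δ := lt_min (by linarith) (by linarith [hy.2])
    have hδ₁ : δ ≤ ε / 2 := min_le_left _ _
    have hδ₂ : δ ≤ (1 - y) / 2 := min_le_right _ _
    obtain ⟨u, hu, hd⟩ := hdense δ hδ (y + δ) ⟨by linarith [hy.1], by linarith [hy.2]⟩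
    rw [abs_lt] at hd
    have := hmono (show y ≤ u by linarith [hd.1])
    linarith [hd.2]
  · set δ := min (ε / 2) (y / 2)
    have hδ : 0 < δ := lt_min (by linarith) (by linarith [hy.1])
    have hδ₁ : δ ≤ ε / 2 := min_le_left _ _
    have hδ₂ : δ ≤ y / 2 := min_le_right _ _
    obtain ⟨u, hu, hd⟩ := hdense δ hδ (y - δ) ⟨by linarith, by linarith [hy.2]⟩
    rw [abs_lt] at hd
    have := hmono (show u ≤ y by linarith [hd.2])
    linarith [hd.1]

theorem measureReal_Iio_of_invariant {lam0 : Fin 4 → ℝ}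
    (h : (⋂ n : ℕ, projMap (H n) '' stdSimplex ℝ (Fin 4)) = {lam0}) {μ : Measure ℝ}
    [IsProbabilityMeasure μ] (hμ : μ (domain lam0)ᶜ = 0)
    (hT : MeasurePreserving (iet lam0 pi0.perm) μ μ) (y : ℝ) :
    μ.real (Set.Iio y) = max 0 (min y 1) := by
  have hmem : lam0 ∈ ⋂ n : ℕ, projMap (H n) '' openSimplex 4 := by
    rw [iInter_image_openSimplex, h]
    exact rfl
  have hlam := mem_openSimplex_of_mem_iInter hmem
  have hmono : Monotone fun y => μ.real (Set.Iio y) := fun a b hab =>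
    measureReal_mono (Set.Iio_subset_Iio hab)
  have h0 : μ.real (Set.Iio 0) = 0 := by
    rw [measureReal_def, measure_mono_null _ hμ, ENNReal.toReal_zero]
    exact fun z hz hz' => hz'.1.not_gt hz
  have h1 : μ.real (Set.Iio 1) = 1 := by
    have : μ.real (Set.Iio (1 : ℝ))ᶜ = 0 := by
      rw [measureReal_def, measure_mono_null _ hμ, ENNReal.toReal_zero]
      intro z hz hz'
      rw [domain, hlam.2] at hz'
      exact hz hz'.2
    have e := probReal_add_probReal_compl (μ := μ) (measurableSet_Iio (a := (1 : ℝ)))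
    linarith
  rcases le_or_gt y 0 with hy | hy
  · rw [max_eq_left ((min_le_left _ _).trans hy)]
    exact le_antisymm ((hmono hy).trans_eq h0) measureReal_nonneg
  rcases lt_or_ge y 1 with hy' | hy'
  · rw [min_eq_left hy'.le, max_eq_right hy.le]
    exact eq_self_of_inv h hmono
      (inv_measureReal_Iio rfl (fun i => (hlam.1 i).le) hμ hT) h0 h1 ⟨hy, hy'⟩
  · rw [min_eq_right hy', max_eq_right zero_le_one]
    exact le_antisymm measureReal_le_one (h1.symm.trans_le (hmono hy'))

theorem isUniquelyErgodic_of_iInter_eq {lam0 : Fin 4 → ℝ}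
    (h : (⋂ n : ℕ, projMap (H n) '' stdSimplex ℝ (Fin 4)) = {lam0}) :
    IsUniquelyErgodic lam0 pi0.perm := by
  have hmem : lam0 ∈ ⋂ n : ℕ, projMap (H n) '' openSimplex 4 := by
    rw [iInter_image_openSimplex, h]
    exact rfl
  have hlam := mem_openSimplex_of_mem_iInter hmem
  have hprob := isProbabilityMeasure_restrict_domain hlam.2
  have hnull : volume.restrict (domain lam0) (domain lam0)ᶜ = 0 := by
    rw [domain, Measure.restrict_apply measurableSet_Ico.compl, Set.compl_inter_self, measure_empty]
  have hpres : MeasurePreserving (iet lam0 pi0.perm) (volume.restrict (domain lam0))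
      (volume.restrict (domain lam0)) :=
    measurePreserving_iet_restrict rfl fun i => (hlam.1 i).le
  refine ⟨volume.restrict (domain lam0), ⟨hprob, hnull, hpres⟩, ?_⟩
  rintro μ ⟨hμ, hμ0, hT⟩
  -- Lebesgue measure on the domain is itself an invariant probability measure, so one formula gives
  -- both distribution functions.
  refine Measure.ext_of_Ici _ _ fun a => ?_
  rw [← measureReal_eq_measureReal_iff, ← Set.compl_Iio,
    probReal_compl_eq_one_sub measurableSet_Iio,
    probReal_compl_eq_one_sub measurableSet_Iio, measureReal_Iio_of_invariant h hμ0 hT,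
    measureReal_Iio_of_invariant h hnull hpres]

end IntervalExchange

theorem mainTheorem2 :
    ∃ lam0 : Fin 4 → ℝ,
      (∀ i, 0 < lam0 i) ∧
      Antitone (fun n : ℕ =>
        IntervalExchange.projMap (IntervalExchange.H n) '' stdSimplex ℝ (Fin 4)) ∧
      (⋂ n : ℕ, IntervalExchange.projMap (IntervalExchange.H n) '' stdSimplex ℝ (Fin 4))
        = {lam0} ∧
      Antitone (fun n : ℕ =>
        IntervalExchange.projMap (IntervalExchange.H n) '' IntervalExchange.openSimplex 4) ∧
      (⋂ n : ℕ, IntervalExchange.projMap (IntervalExchange.H n) '' IntervalExchange.openSimplex 4)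
        = {lam0} ∧
      IntervalExchange.IsMinimal lam0 IntervalExchange.pi0.perm ∧
      IntervalExchange.IsUniquelyErgodic lam0 IntervalExchange.pi0.perm := by
  obtain ⟨lam0, h⟩ := IntervalExchange.exists_iInter_image_stdSimplex_eq_singleton
  have h' := IntervalExchange.iInter_image_openSimplex.trans h
  have hmem := h'.symm.subset rfl
  exact ⟨lam0, (IntervalExchange.mem_openSimplex_of_mem_iInter hmem).1,
    IntervalExchange.antitone_image_stdSimplex, h, IntervalExchange.antitone_image_openSimplex, h',
    IntervalExchange.isMinimal_of_mem_iInter hmem,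
    IntervalExchange.isUniquelyErgodic_of_iInter_eq h⟩
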